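/- Let $S=K[x_1,\dots,x_n]$ be the standard graded polynomial ring over a field $K$ and $\mathfrak m=(x_1,\dots,x_n)$. For an ideal $I\subseteq S$ and $k\ge 0$ put $I^{(k)}=\bigcap_{P\in\mathrm{Ass}(S/I)}(I^kS_P\cap S)$, let $\mathcal G(I)$ be the set of minimal monomial generators of a monomial ideal $I$, and let $\omega(I)=\max\{d:(I/\mathfrak mI)_d\neq0\}$. If $\bigoplus_j S(-a_{ij})$, $i\ge0$, are the modules in the minimal graded free resolution of $I$, then $\mathrm{reg}\,I=\max_{i,j}\{a_{ij}-i\}$, and $I$ has a linear resolution if there is a $c$ with $a_{ij}=c+i$ for all $i,j$; $I$ has linear powers if $I^k$ has a linear resolution for all $k\ge1$. (The maximum of the empty set is $-\infty$; this concerns only $I=0$.) For a monomial ideal $I$ the symbolic Rees algebra $\mathcal R_s(I)=\bigoplus_{k\ge0}I^{(k)}t^k\subseteq S[t]$ is generated over $K$ by its minimal monomial generators $x_1,\dots,x_n,u_1t^{q_1},\dots,u_mt^{q_m}$, where $u_s\in S$ are monomials and $q_s>0$. Let $T=K[x_1,\dots,x_n,y_1,\dots,y_m]$ with $\mathrm{bideg}(x_i)=(1,0)$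 and $\mathrm{bideg}(y_s)=(\deg u_s,q_s)$, and regard $\mathcal R_s(I)$ as a bigraded $T$-module through $x_i\mapsto x_i$, $y_s\mapsto u_st^{q_s}$, where $ft^b$ has bidegree $(a,b)$ if $f$ is homogeneous of degree $a$. If $\bigoplus_jT(-a_{ij},-b_{ij})$, $i\ge0$, are the modules in its minimal bigraded free $T$-resolution, put $\mathrm{reg}_x\mathcal R_s(I)=\max_{i,j}\{a_{ij}-i\}$. For $k\ge1$ let $d(I,k)=\max\{\sum_{s=1}^m c_s\deg(u_s): c\in\mathbb Z_{\ge0}^m,\ \sum_{s=1}^m c_sq_s\le k\}$. **Theorem.** Let $I\subseteq S$ be a monomial ideal of minimal intersection type, that is, $I$ is a finite intersection of powers of monomial prime ideals and has no embedded associated primes. Then: (a) $u^k\in\mathcal G(I^{(k)})$ for all $u\in\mathcal G(I)$ and all $k\ge1$. (b) $\mathrm{reg}\,I^{(k)}\ge\omega(I^{(k)})\ge\omega(I)k$ for all $k\ge1$. (c) If $I$ has linear powers, then $\mathrm{reg}\,I^{(k)}\ge\mathrm{reg}\,I^k$ for all $k\ge1$. (d) If $I$ has linear powers, $\mathrm{reg}_x\mathcal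 R_s(I)=0$ and $d(I,k)=\omega(I)k$ for all $k\ge1$, then $\mathrm{reg}\,I^{(k)}=\mathrm{reg}\,I^k$ for all $k\ge1$. -/

import Mathlib

noncomputable section

namespace SymbolicReg

open MvPolynomial

/-! ## Graded free resolutions over a polynomial ring -/

/-- Let `R = K[x_s : s ∈ σ]` be graded by an abelian group `A` with `deg x_s = w s`, and let `M` be
an `A`-graded `R`-module, `𝓜 a` being the set of homogeneous elements of `M` of degree `a`.
A graded free resolution `⋯ → F₁ → F₀ → M → 0` of `M`, where `F_i = ⨁_j R(-shift i j)` is a free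
module of finite rank whose `j`-th basis element is homogeneous of degree `shift i j`, and all maps
are homogeneous of degree zero. -/
structure GradedFreeResolution {K σ A M : Type*} [Field K] [AddCommGroup A] (w : σ → A)
    [AddCommGroup M] [Module (MvPolynomial σ K) M] (𝓜 : A → Set M) where
  rank : ℕ → ℕ
  shift : ∀ i, Fin (rank i) → A
  d : ∀ i, (Fin (rank (i + 1)) → MvPolynomial σ K) →ₗ[MvPolynomial σ K]
    (Fin (rank i) → MvPolynomial σ K)
  ε : (Fin (rank 0) → MvPolynomial σ K) →ₗ[MvPolynomial σ K] M
  d_homogeneous : ∀ i j j',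
    IsWeightedHomogeneous w (d i (Pi.single j 1) j') (shift (i + 1) j - shift i j')
  ε_homogeneous : ∀ j, ε (Pi.single j 1) ∈ 𝓜 (shift 0 j)
  ε_surjective : Function.Surjective ε
  exact_zero : Function.Exact (d 0) ε
  exact_succ : ∀ i, Function.Exact (d (i + 1)) (d i)

/-- A graded free resolution is minimal if `d (F_{i+1}) ⊆ 𝔪 F_i` for all `i`, where `𝔪` is the ideal
generated by all the variables. -/
def GradedFreeResolution.IsMinimal {K σ A M : Type*} [Field K] [AddCommGroup A] {w : σ → A}
    [AddCommGroup M] [Module (MvPolynomial σ K) M] {𝓜 : A → Set M}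
    (F : GradedFreeResolution (K := K) w 𝓜) : Prop :=
  ∀ i v j, F.d i v j ∈ Ideal.span (Set.range (X : σ → MvPolynomial σ K))

/-- The set of the shifts `a` of the summands `R(-a)` in homological degree `i` of the (unique up to
isomorphism) minimal graded free resolution. -/
def minimalShifts (K : Type*) {σ A M : Type*} [Field K] [AddCommGroup A] (w : σ → A)
    [AddCommGroup M] [Module (MvPolynomial σ K) M] (𝓜 : A → Set M) (i : ℕ) : Set A :=
  {a | ∃ F : GradedFreeResolution (K := K) w 𝓜, F.IsMinimal ∧ ∃ j, F.shift i j = a}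

/-! ## Ideals of the standard graded polynomial ring `S = K[x_1, …, x_n]` -/

section Ideals

variable {K : Type*} [Field K] {n : ℕ}

/-- The standard grading: the homogeneous elements of degree `a` of the ideal `I`. -/
def idealDegree (I : Ideal (MvPolynomial (Fin n) K)) (a : ℤ) : Set I :=
  {f | IsWeightedHomogeneous (fun _ : Fin n => (1 : ℤ)) (f : MvPolynomial (Fin n) K) a}

/-- The shifts in homological degree `i` of the minimal graded free `S`-resolution of `I`. -/
def idealShifts (I : Ideal (MvPolynomial (Fin n) K)) (i : ℕ) : Set ℤ :=
  minimalShifts K (fun _ : Fin n => (1 : ℤ)) (idealDegree I) i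

/-- The Castelnuovo–Mumford regularity `reg I = max {a - i}`, over all summands `S(-a)` in
homological degree `i` of the minimal graded free resolution of `I` (`-∞` for `I = 0`). -/
def reg (I : Ideal (MvPolynomial (Fin n) K)) : EReal :=
  ⨆ i : ℕ, ⨆ a ∈ idealShifts I i, (((a - i : ℤ) : ℝ) : EReal)

/-- `I` has a linear resolution: for some `c`, the module in homological degree `i` of its minimal
graded free resolution is a direct sum of copies of `S(-(c + i))`. -/
def HasLinearResolution (I : Ideal (MvPolynomial (Fin n) K)) : Prop :=
  ∃ c : ℤ, ∀ i : ℕ, ∀ a ∈ idealShifts I i, a = c + i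

/-- All the powers of `I` have a linear resolution. -/
def HasLinearPowers (I : Ideal (MvPolynomial (Fin n) K)) : Prop :=
  ∀ k : ℕ, 1 ≤ k → HasLinearResolution (I ^ k)

/-- The final degree `ω(I) = max {d : (I / 𝔪 I)_d ≠ 0}` (`-∞` for `I = 0`). -/
def finalDegree (I : Ideal (MvPolynomial (Fin n) K)) : EReal :=
  ⨆ d ∈ {d : ℕ | ∃ f ∈ I, f.IsHomogeneous d ∧
    f ∉ Ideal.span (Set.range (X : Fin n → MvPolynomial (Fin n) K)) * I}, (d : EReal)

/-- `I` is generated by monomials. -/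
def IsMonomialIdeal (I : Ideal (MvPolynomial (Fin n) K)) : Prop :=
  ∃ E : Set (Fin n →₀ ℕ), I = Ideal.span ((fun a => monomial a (1 : K)) '' E)

/-- `𝒢(I)`: the monomials of `I` that are minimal with respect to divisibility. -/
def minimalGenerators (I : Ideal (MvPolynomial (Fin n) K)) : Set (MvPolynomial (Fin n) K) :=
  {u | ∃ a : Fin n →₀ ℕ, u = monomial a 1 ∧ u ∈ I ∧
    ∀ b : Fin n →₀ ℕ, monomial b (1 : K) ∈ I → b ≤ a → b = a}

/-- `I` is a finite intersection of powers of monomial prime ideals. -/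
def IsIntersectionType (I : Ideal (MvPolynomial (Fin n) K)) : Prop :=
  ∃ (m : ℕ) (P : Fin m → Ideal (MvPolynomial (Fin n) K)) (e : Fin m → ℕ),
    (∀ i, (P i).IsPrime ∧ IsMonomialIdeal (P i) ∧ 1 ≤ e i) ∧ I = ⨅ i, P i ^ e i

/-- `I` is of intersection type and has no embedded associated primes. -/
def IsMinimalIntersectionType (I : Ideal (MvPolynomial (Fin n) K)) : Prop :=
  IsIntersectionType I ∧
    ∀ P ∈ associatedPrimes (MvPolynomial (Fin n) K) (MvPolynomial (Fin n) K ⧸ I),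
    ∀ Q ∈ associatedPrimes (MvPolynomial (Fin n) K) (MvPolynomial (Fin n) K ⧸ I),
      P ≤ Q → P = Q

end Ideals

/-! ## Symbolic powers and the symbolic Rees algebra -/

/-- The symbolic power `I^(k) = ⋂_{P ∈ Ass(I)} (I^k R_P ∩ R)`. -/
def symbolicPower {R : Type*} [CommRing R] [IsNoetherianRing R] (I : Ideal R) (k : ℕ) : Ideal R :=
  ⨅ P : associatedPrimes R (R ⧸ I),
    haveI : P.1.IsPrime := P.2.isPrime
    ((I ^ k).map (algebraMap R (Localization.AtPrime P.1))).comap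
      (algebraMap R (Localization.AtPrime P.1))

theorem symbolicPower_zero {R : Type*} [CommRing R] [IsNoetherianRing R] (I : Ideal R) :
    symbolicPower I 0 = ⊤ := by
  simp [symbolicPower, Ideal.one_eq_top, Ideal.map_top]

theorem mul_mem_symbolicPower {R : Type*} [CommRing R] [IsNoetherianRing R] {I : Ideal R}
    {k l : ℕ} {f g : R} (hf : f ∈ symbolicPower I k) (hg : g ∈ symbolicPower I l) :
    f * g ∈ symbolicPower I (k + l) := by
  simp only [symbolicPower, Ideal.mem_iInf, Ideal.mem_comap] at *
  intro P
  rw [map_mul, pow_add, Ideal.map_mul]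
  exact Ideal.mul_mem_mul (hf P) (hg P)

/-- The symbolic Rees algebra `⨁_k I^(k) t^k`, as a subalgebra of `R[t]`. -/
def symbolicRees {R : Type*} [CommRing R] [IsNoetherianRing R] (I : Ideal R) :
    Subalgebra R (Polynomial R) where
  carrier := {f | ∀ k, f.coeff k ∈ symbolicPower I k}
  mul_mem' := fun {f g} hf hg k => by
    rw [Polynomial.coeff_mul]
    refine Ideal.sum_mem _ fun p hp => ?_
    rw [← Finset.HasAntidiagonal.mem_antidiagonal.mp hp]
    exact mul_mem_symbolicPower (hf p.1) (hg p.2)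
  add_mem' := fun {f g} hf hg k => by
    rw [Polynomial.coeff_add]
    exact Ideal.add_mem _ (hf k) (hg k)
  algebraMap_mem' := fun r k => by
    rw [Polynomial.algebraMap_apply, Polynomial.coeff_C]
    split_ifs with h
    · subst h
      simp [symbolicPower_zero]
    · exact Ideal.zero_mem _

section Rees

variable {K : Type*} [Field K] {n : ℕ}

/-- The pairs `(a, q)` with `q > 0` such that `x^a t^q` is a minimal monomial generator of the
symbolic Rees algebra, that is, `x^a t^q` lies in it and is not a product of two monomials of it
both different from `1`. -/
def reesGenerators (I : Ideal (MvPolynomial (Fin n) K)) : Set ((Fin n →₀ ℕ) × ℕ) :=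
  {g | 0 < g.2 ∧ monomial g.1 1 ∈ symbolicPower I g.2 ∧
    ∀ g₁ g₂ : (Fin n →₀ ℕ) × ℕ, monomial g₁.1 1 ∈ symbolicPower I g₁.2 →
      monomial g₂.1 1 ∈ symbolicPower I g₂.2 → g₁ + g₂ = g → g₁ = 0 ∨ g₂ = 0}

/-- The element `x^a t^q` of the symbolic Rees algebra, for `(a, q) ∈ reesGenerators I`. -/
def reesGenerator (I : Ideal (MvPolynomial (Fin n) K)) (g : reesGenerators I) : symbolicRees I :=
  ⟨Polynomial.monomial g.1.2 (monomial g.1.1 1), fun k => by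
    rw [Polynomial.coeff_monomial]
    split_ifs with h
    · exact h ▸ g.2.2.1
    · exact Ideal.zero_mem _⟩

/-- The presentation `φ : T = K[x_1, …, x_n, y_1, …, y_m] → R_s(I)` with `x_i ↦ x_i` and
`y_j ↦ u_j t^{q_j}`, where the `y_j` are indexed by the generators `u_j t^{q_j}` with `q_j > 0`. -/
def reesPresentation (I : Ideal (MvPolynomial (Fin n) K)) :
    MvPolynomial (Fin n ⊕ reesGenerators I) K →ₐ[K] symbolicRees I :=
  aeval (Sum.elim (fun i => algebraMap (MvPolynomial (Fin n) K) (symbolicRees I) (X i))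
    (reesGenerator I))

/-- The bigrading of `T`: `bideg x_i = (1, 0)` and `bideg y_j = (deg u_j, q_j)`. -/
def reesWeight (I : Ideal (MvPolynomial (Fin n) K)) : Fin n ⊕ reesGenerators I → ℤ × ℤ :=
  Sum.elim (fun _ => (1, 0)) (fun g => ((g.1.1.degree : ℤ), (g.1.2 : ℤ)))

/-- The bigrading of `R_s(I)`: the elements of bidegree `(a, b)` are the `f t^b`, where `f ∈ I^(b)`
is homogeneous of degree `a`. -/
def reesDegree (I : Ideal (MvPolynomial (Fin n) K)) (c : ℤ × ℤ) : Set (symbolicRees I) :=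
  {f | ∀ k : ℕ,
    IsWeightedHomogeneous (fun _ : Fin n => (1 : ℤ)) ((f : Polynomial (MvPolynomial (Fin n) K)).coeff k) c.1 ∧
    ((k : ℤ) ≠ c.2 → (f : Polynomial (MvPolynomial (Fin n) K)).coeff k = 0)}

/-- The shifts in homological degree `i` of the minimal bigraded free `T`-resolution of `R_s(I)`,
which is a `T`-module through `φ`. -/
def reesShifts (I : Ideal (MvPolynomial (Fin n) K)) (i : ℕ) : Set (ℤ × ℤ) :=
  letI : Module (MvPolynomial (Fin n ⊕ reesGenerators I) K) (symbolicRees I) :=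
    Module.compHom _ (reesPresentation I).toRingHom
  minimalShifts K (reesWeight I) (reesDegree I) i

/-- The `x`-regularity `reg_x R_s(I) = max {a - i}`, over all summands `T(-a, -b)` in homological
degree `i` of the minimal bigraded free `T`-resolution of `R_s(I)`. -/
def regX (I : Ideal (MvPolynomial (Fin n) K)) : EReal :=
  ⨆ i : ℕ, ⨆ c ∈ reesShifts I i, (((c.1 - i : ℤ) : ℝ) : EReal)

/-- `d(I, k) = max ∑_s c_s deg(u_s)`, over all families `(c_s)` of natural numbers with
`∑_s c_s q_s ≤ k`, where `u_s t^{q_s}` are the minimal monomial generators of `R_s(I)` with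
`q_s > 0`. -/
def dMax (I : Ideal (MvPolynomial (Fin n) K)) (k : ℕ) : EReal :=
  ⨆ c ∈ {c : reesGenerators I →₀ ℕ | c.sum (fun g m => m * g.1.2) ≤ k},
    ((c.sum (fun g m => m * g.1.1.degree) : ℕ) : EReal)

end Rees

end SymbolicReg

end

/-!
If `I = ⋂ P_i ^ e_i`, then `I ⊆ P_i ^ e_i` forces `I^(k) ⊆ P_i ^ (e_i k)` as soon as `P_i` is
contained in an associated prime of `I`, and these `P_i ^ e_i` already cut out `I`. If `x_i` divides
`u ∈ 𝒢(I)`, then `u / x_i` lies outside one of them, which means that the order of `u` along `P_i`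
is exactly `e_i`; a monomial of `I^(k)` properly dividing `u ^ k` would have too small an order.
Hence `u ^ k ∈ 𝒢(I^(k))`, so that `ω(I^(k)) ≥ ω(I) k`, and `reg ≥ ω` because minimal generators are
shifts in homological degree `0`. If `I` has linear powers, then `reg I ^ k = ω(I) k`.

For the upper bound, the part of degree `k` in `t` of the minimal bigraded `T`-resolution of
`R_s(I)` is a graded `S`-resolution of `I^(k)`, in general not minimal. The minimal resolution of
`I^(k)` is a direct summand of it, and each `T(-a, -b)` in homological degree `i` contributes
generators of degrees `a + deg y^c` with `b + ∑ c_s q_s = k`. Therefore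
`reg I^(k) ≤ d(I, k) + reg_x R_s(I)`.
-/

noncomputable section

namespace SymbolicReg

open MvPolynomial

/-! ## Projective resolutions -/

theorem exists_dependent_seq {α : ℕ → Type*} {P : ∀ i, α i → Prop}
    {R : ∀ i, α i → α (i + 1) → Prop} {a₀ : α 0} (h₀ : P 0 a₀)
    (hs : ∀ i a, P i a → ∃ b, P (i + 1) b ∧ R i a b) :
    ∃ f : ∀ i, α i, f 0 = a₀ ∧ (∀ i, P i (f i)) ∧ ∀ i, R i (f i) (f (i + 1)) := by
  choose g hg hg' using hs
  let f : ∀ i, {a : α i // P i a} := fun i =>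
    Nat.rec ⟨a₀, h₀⟩ (fun i x => ⟨g i x.1 x.2, hg i x.1 x.2⟩) i
  exact ⟨fun i => (f i).1, rfl, fun i => (f i).2, fun i => hg' i (f i).1 (f i).2⟩

section Projective

variable {S : Type*} [CommRing S]

theorem exists_comp_eq_of_range_le {P M N : Type*} [AddCommGroup P] [Module S P]
    [Module.Projective S P] [AddCommGroup M] [Module S M] [AddCommGroup N] [Module S N]
    {d : M →ₗ[S] N} {g : P →ₗ[S] N} (h : LinearMap.range g ≤ LinearMap.range d) :
    ∃ l : P →ₗ[S] M, d ∘ₗ l = g := by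
  obtain ⟨l, hl⟩ := Module.projective_lifting_property d.rangeRestrict
    (g.codRestrict _ fun x => h (LinearMap.mem_range_self g x)) d.surjective_rangeRestrict
  exact ⟨l, LinearMap.ext fun x => congrArg Subtype.val (LinearMap.congr_fun hl x)⟩

theorem range_le_range_of_comp_eq_zero {P M N L : Type*} [AddCommGroup P] [Module S P]
    [AddCommGroup M] [Module S M] [AddCommGroup N] [Module S N] [AddCommGroup L] [Module S L]
    {d : M →ₗ[S] N} {e : N →ₗ[S] L} (hde : Function.Exact d e) {g : P →ₗ[S] N}
    (h : e ∘ₗ g = 0) : LinearMap.range g ≤ LinearMap.range d := by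
  rw [← hde.linearMap_ker_eq, LinearMap.range_le_ker_iff, h]

variable {F G : ℕ → Type*} [∀ i, AddCommGroup (F i)] [∀ i, Module S (F i)]
  [∀ i, AddCommGroup (G i)] [∀ i, Module S (G i)]
  {M N : Type*} [AddCommGroup M] [Module S M] [AddCommGroup N] [Module S N]

/-- `⋯ → F 1 → F 0 → M → 0` is exact. -/
structure IsResolution (d : ∀ i, F (i + 1) →ₗ[S] F i) (ε : F 0 →ₗ[S] M) : Prop where
  surjective : Function.Surjective ε
  exact_zero : Function.Exact (d 0) ε
  exact_succ : ∀ i, Function.Exact (d (i + 1)) (d i)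

variable {dF : ∀ i, F (i + 1) →ₗ[S] F i} {εF : F 0 →ₗ[S] M}
  {dG : ∀ i, G (i + 1) →ₗ[S] G i} {εG : G 0 →ₗ[S] N}

theorem IsResolution.exists_lift [∀ i, Module.Projective S (G i)] (hF : IsResolution dF εF)
    (hG : IsResolution dG εG) (f : N →ₗ[S] M) :
    ∃ ψ : ∀ i, G i →ₗ[S] F i, εF ∘ₗ ψ 0 = f ∘ₗ εG ∧ ∀ i, dF i ∘ₗ ψ (i + 1) = ψ i ∘ₗ dG i := by
  obtain ⟨ψ₀, hψ₀⟩ := Module.projective_lifting_property εF (f ∘ₗ εG) hF.surjective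
  obtain ⟨ψ, rfl, -, hψ⟩ := exists_dependent_seq (α := fun i => G i →ₗ[S] F i)
    (P := fun i ψ => LinearMap.range (ψ ∘ₗ dG i) ≤ LinearMap.range (dF i))
    (R := fun i ψ ψ' => dF i ∘ₗ ψ' = ψ ∘ₗ dG i) (a₀ := ψ₀)
    (range_le_range_of_comp_eq_zero hF.exact_zero (by
      rw [← LinearMap.comp_assoc, hψ₀, LinearMap.comp_assoc,
        hG.exact_zero.linearMap_comp_eq_zero, LinearMap.comp_zero])) fun i ψ hψ => by
    obtain ⟨ψ', hψ'⟩ := exists_comp_eq_of_range_le hψ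
    refine ⟨ψ', range_le_range_of_comp_eq_zero (hF.exact_succ i) ?_, hψ'⟩
    rw [← LinearMap.comp_assoc, hψ', LinearMap.comp_assoc,
      (hG.exact_succ i).linearMap_comp_eq_zero, LinearMap.comp_zero]
  exact ⟨ψ, hψ₀, hψ⟩

theorem IsResolution.exists_nullHomotopy [∀ i, Module.Projective S (G i)]
    (hF : IsResolution dF εF) (hG : IsResolution dG εG) {χ : ∀ i, G i →ₗ[S] F i}
    (hχ₀ : εF ∘ₗ χ 0 = 0) (hχ : ∀ i, dF i ∘ₗ χ (i + 1) = χ i ∘ₗ dG i) :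
    ∃ h : ∀ i, G i →ₗ[S] F (i + 1), χ 0 = dF 0 ∘ₗ h 0 ∧
      ∀ i, χ (i + 1) = dF (i + 1) ∘ₗ h (i + 1) + h i ∘ₗ dG i := by
  obtain ⟨h₀, hh₀⟩ := exists_comp_eq_of_range_le
    (range_le_range_of_comp_eq_zero hF.exact_zero hχ₀)
  obtain ⟨h, rfl, -, hh⟩ := exists_dependent_seq (α := fun i => G i →ₗ[S] F (i + 1))
    (P := fun i h => dF i ∘ₗ h ∘ₗ dG i = χ i ∘ₗ dG i)
    (R := fun i h h' => χ (i + 1) = dF (i + 1) ∘ₗ h' + h ∘ₗ dG i) (a₀ := h₀)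
    (by rw [← LinearMap.comp_assoc, hh₀]) fun i h hh => by
    obtain ⟨h', hh'⟩ := exists_comp_eq_of_range_le (g := χ (i + 1) - h ∘ₗ dG i)
      (range_le_range_of_comp_eq_zero (hF.exact_succ i) (by
        rw [LinearMap.comp_sub, hχ, hh, sub_self]))
    refine ⟨h', ?_, by rw [hh', sub_add_cancel]⟩
    rw [← LinearMap.comp_assoc, hh', LinearMap.sub_comp, LinearMap.comp_assoc,
      (hG.exact_succ i).linearMap_comp_eq_zero, LinearMap.comp_zero, sub_zero]
  exact ⟨h, hh₀.symm, hh⟩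

theorem map_mem_smul_top {𝔪 : Ideal S} (f : M →ₗ[S] N) {x : M}
    (hx : x ∈ 𝔪 • (⊤ : Submodule S M)) : f x ∈ 𝔪 • (⊤ : Submodule S N) :=
  Submodule.smul_top_le_comap_smul_top 𝔪 f hx

theorem IsResolution.sub_self_mem_smul_top [∀ i, Module.Projective S (F i)]
    (hF : IsResolution dF εF) {𝔪 : Ideal S} (hmin : ∀ i x, dF i x ∈ 𝔪 • (⊤ : Submodule S (F i)))
    {χ : ∀ i, F i →ₗ[S] F i} (hχ₀ : εF ∘ₗ χ 0 = εF)
    (hχ : ∀ i, dF i ∘ₗ χ (i + 1) = χ i ∘ₗ dF i) (i : ℕ) (x : F i) :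
    χ i x - x ∈ 𝔪 • (⊤ : Submodule S (F i)) := by
  obtain ⟨h, h₀, hh⟩ := hF.exists_nullHomotopy hF (χ := fun i => χ i - LinearMap.id)
    (by rw [LinearMap.comp_sub, hχ₀, LinearMap.comp_id, sub_self])
    fun i => by rw [LinearMap.comp_sub, LinearMap.sub_comp, hχ, LinearMap.comp_id,
      LinearMap.id_comp]
  cases i with
  | zero =>
    have hx : χ 0 x - x = dF 0 (h 0 x) := LinearMap.congr_fun h₀ x
    exact hx ▸ hmin 0 (h 0 x)
  | succ i =>
    have hx : χ (i + 1) x - x = dF (i + 1) (h (i + 1) x) + h i (dF i x) :=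
      LinearMap.congr_fun (hh i) x
    exact hx ▸ add_mem (hmin _ _) (map_mem_smul_top (h i) (hmin i x))

theorem IsResolution.mem_smul_top_of_lift_mem [∀ i, Module.Projective S (F i)]
    [∀ i, Module.Projective S (G i)] (hF : IsResolution dF εF) (hG : IsResolution dG εG)
    {𝔪 : Ideal S} (hmin : ∀ i x, dF i x ∈ 𝔪 • (⊤ : Submodule S (F i)))
    {f : M →ₗ[S] N} {r : N →ₗ[S] M} (hr : r ∘ₗ f = LinearMap.id)
    {φ : ∀ i, F i →ₗ[S] G i} (hφ₀ : εG ∘ₗ φ 0 = f ∘ₗ εF)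
    (hφ : ∀ i, dG i ∘ₗ φ (i + 1) = φ i ∘ₗ dF i) {i : ℕ} {x : F i}
    (hx : φ i x ∈ 𝔪 • (⊤ : Submodule S (G i))) : x ∈ 𝔪 • (⊤ : Submodule S (F i)) := by
  obtain ⟨ψ, hψ₀, hψ⟩ := hF.exists_lift hG r
  have hsub : ψ i (φ i x) - x ∈ 𝔪 • (⊤ : Submodule S (F i)) :=
    hF.sub_self_mem_smul_top hmin (χ := fun i => ψ i ∘ₗ φ i)
      (by rw [← LinearMap.comp_assoc, hψ₀, LinearMap.comp_assoc, hφ₀, ← LinearMap.comp_assoc, hr,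
        LinearMap.id_comp])
      (fun i => by rw [← LinearMap.comp_assoc, hψ, LinearMap.comp_assoc, hφ,
        LinearMap.comp_assoc]) i x
  simpa using sub_mem (map_mem_smul_top (ψ i) hx) hsub

end Projective

/-! ## Graded modules over a polynomial ring -/

theorem map_eq_sum_smul_single {ι R N : Type*} [CommRing R] [AddCommGroup N] [Module R N]
    [Fintype ι] [DecidableEq ι] (l : (ι → R) →ₗ[R] N) (f : ι → R) :
    l f = ∑ j, f j • l (Pi.single j 1) := by
  conv_lhs => rw [pi_eq_sum_univ' f, map_sum]
  exact Finset.sum_congr rfl fun j _ => map_smul l _ _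

theorem mem_smul_top_pi_iff {ι R N : Type*} [Finite ι] [CommRing R]
    [AddCommGroup N] [Module R N] {J : Ideal R} {f : ι → N} :
    f ∈ J • (⊤ : Submodule R (ι → N)) ↔ ∀ j, f j ∈ J • (⊤ : Submodule R N) := by
  classical
  have := Fintype.ofFinite ι
  refine ⟨fun hf j => map_mem_smul_top (LinearMap.proj j) hf, fun hf => ?_⟩
  rw [← Finset.univ_sum_single f]
  exact sum_mem fun j _ => map_mem_smul_top (LinearMap.single R (fun _ => N) j) (hf j)

section Graded

variable {K σ A M : Type*} [Field K] [AddCommGroup A] {w : σ → A}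
  [AddCommGroup M] [Module (MvPolynomial σ K) M]

/-- The sets `𝓜 a` of homogeneous elements of an `R`-module `M`, where `R = K[x_s : s ∈ σ]` is
graded by the weights `w`, together with projections `p a` onto `𝓜 a` that annihilate the other
`𝓜 b`. An element of `M` need not be the sum of its projections, so that one may take a family of
pieces of a finer grading, with the remaining pieces killed by all `p a`. -/
structure GradingProj (w : σ → A) (𝓜 : A → Set M) (p : A → M →+ M) : Prop where
  smul_mem : ∀ {a b : A} {f : MvPolynomial σ K} {m : M}, IsWeightedHomogeneous w f a →
    m ∈ 𝓜 b → f • m ∈ 𝓜 (a + b)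
  proj_of_mem : ∀ {a : A} {m : M}, m ∈ 𝓜 a → p a m = m
  proj_of_ne : ∀ {a b : A} {m : M}, m ∈ 𝓜 a → b ≠ a → p b m = 0
  proj_mem : ∀ a m, p a m ∈ 𝓜 a

variable {𝓜 : A → Set M} {p : A → M →+ M}

theorem GradingProj.proj_smul (h : GradingProj (K := K) w 𝓜 p) {b : A} {m : M} (hm : m ∈ 𝓜 b)
    (a : A) (f : MvPolynomial σ K) :
    p a (f • m) = weightedHomogeneousComponent w (a - b) f • m := by
  classical
  induction f using MvPolynomial.induction_on' with
  | add f g hf hg => simp only [add_smul, map_add, hf, hg]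
  | monomial d c =>
    have hd := isWeightedHomogeneous_monomial w d c rfl
    have hmem := h.smul_mem hd hm
    by_cases ha : a = Finsupp.weight w d + b
    · subst ha
      rw [h.proj_of_mem hmem, add_sub_cancel_right, hd.weightedHomogeneousComponent_same]
    · rw [h.proj_of_ne hmem ha, hd.weightedHomogeneousComponent_ne _ (mt sub_eq_iff_eq_add.1 ha),
        zero_smul]

variable {ι : Type*}

/-- The homogeneous elements of degree `a` of the graded free module `⨁_j R(-s j)`. -/
def freeDegree (K : Type*) [Field K] (w : σ → A) (s : ι → A) (a : A) :
    Set (ι → MvPolynomial σ K) :=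
  {f | ∀ j, IsWeightedHomogeneous w (f j) (a - s j)}

/-- The homogeneous component of degree `a` in the graded free module `⨁_j R(-s j)`. -/
def freeProj (K : Type*) [Field K] (w : σ → A) (s : ι → A) (a : A) :
    (ι → MvPolynomial σ K) →+ (ι → MvPolynomial σ K) where
  toFun f j := weightedHomogeneousComponent w (a - s j) (f j)
  map_zero' := by ext; simp
  map_add' f g := by ext; simp

theorem gradingProj_free (s : ι → A) :
    GradingProj (K := K) w (freeDegree K w s) (freeProj K w s) where
  smul_mem hf hm j := by simpa [add_sub_assoc] using hf.mul (hm j)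
  proj_of_mem hm := funext fun j => by
    classical exact (hm j).weightedHomogeneousComponent_same
  proj_of_ne hm hab := funext fun j => by
    classical exact (hm j).weightedHomogeneousComponent_ne _ (by simpa using hab)
  proj_mem _ _ _ := weightedHomogeneousComponent_isWeightedHomogeneous _ _

variable [Finite ι] [DecidableEq ι]

theorem GradingProj.proj_map (h : GradingProj (K := K) w 𝓜 p) {s : ι → A}
    {l : (ι → MvPolynomial σ K) →ₗ[MvPolynomial σ K] M} (hl : ∀ j, l (Pi.single j 1) ∈ 𝓜 (s j))
    (a : A) (f : ι → MvPolynomial σ K) : p a (l f) = l (freeProj K w s a f) := by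
  cases nonempty_fintype ι
  rw [map_eq_sum_smul_single l f, map_eq_sum_smul_single l (freeProj K w s a f), map_sum]
  exact Finset.sum_congr rfl fun j _ => h.proj_smul (hl j) a _

theorem GradingProj.exists_homogeneous_preimage (h : GradingProj (K := K) w 𝓜 p) {s : ι → A}
    {l : (ι → MvPolynomial σ K) →ₗ[MvPolynomial σ K] M} (hl : ∀ j, l (Pi.single j 1) ∈ 𝓜 (s j))
    {a : A} {m : M} (hm : m ∈ 𝓜 a) (hm' : m ∈ Set.range l) :
    ∃ f ∈ freeDegree K w s a, l f = m := by
  obtain ⟨f, rfl⟩ := hm'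
  exact ⟨freeProj K w s a f, (gradingProj_free s).proj_mem _ _, by
    rw [← h.proj_map hl, h.proj_of_mem hm]⟩

theorem GradingProj.map_mem (h : GradingProj (K := K) w 𝓜 p) {s : ι → A}
    {l : (ι → MvPolynomial σ K) →ₗ[MvPolynomial σ K] M} (hl : ∀ j, l (Pi.single j 1) ∈ 𝓜 (s j))
    {a : A} {f : ι → MvPolynomial σ K} (hf : f ∈ freeDegree K w s a) : l f ∈ 𝓜 a := by
  rw [← (gradingProj_free s).proj_of_mem hf, ← h.proj_map hl]
  exact h.proj_mem a _

end Graded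

/-! ## Minimal graded free resolutions -/

section Resolution

variable {K σ A M : Type*} [Field K] [AddCommGroup A] {w : σ → A}
  [AddCommGroup M] [Module (MvPolynomial σ K) M] {𝓜 : A → Set M} {p : A → M →+ M}

theorem mem_idealOfVars_iff {R : Type*} [CommSemiring R] {f : MvPolynomial σ R} :
    f ∈ idealOfVars σ R ↔ coeff 0 f = 0 := by
  rw [← pow_one (idealOfVars σ R), mem_pow_idealOfVars_iff']
  simp only [Nat.lt_one_iff, Finsupp.degree_eq_zero_iff, forall_eq]

theorem exists_irredundant_finset {R N : Type*} [Semiring R] [AddCommMonoid N] [Module R N]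
    {s : Set N} (hs : (Submodule.span R s).FG) :
    ∃ t : Finset N, ↑t ⊆ s ∧ Submodule.span R (t : Set N) = Submodule.span R s ∧
      ∀ x ∈ t, x ∉ Submodule.span R ((t : Set N) \ {x}) := by
  classical
  obtain ⟨t₀, ht₀, hspan₀⟩ := (Submodule.fg_span_iff_fg_span_finset_subset s).1 hs
  obtain ⟨t, ⟨hts, hspan⟩, hmin⟩ := exists_minimal_of_wellFoundedLT
    (fun t : Finset N => ↑t ⊆ s ∧ Submodule.span R (t : Set N) = Submodule.span R s)
    ⟨t₀, ht₀, hspan₀.symm⟩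
  refine ⟨t, hts, hspan, fun x hx hmem => ?_⟩
  rw [← Finset.coe_erase] at hmem
  have herase : Submodule.span R (t.erase x : Set N) = Submodule.span R s := by
    rw [← hspan, ← Submodule.span_insert_eq_span hmem, ← Finset.coe_insert, Finset.insert_erase hx]
  exact Finset.notMem_erase x t (hmin
    ⟨(Finset.coe_subset.2 (Finset.erase_subset x t)).trans hts,
      herase⟩ (Finset.erase_subset x t) hx)

theorem weightedHomogeneousComponent_zero_eq_C
    (hw : ∀ d : σ →₀ ℕ, Finsupp.weight w d = 0 → d = 0) (f : MvPolynomial σ K) :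
    weightedHomogeneousComponent w 0 f = C (coeff 0 f) := by
  classical
  ext d
  rw [coeff_weightedHomogeneousComponent, coeff_C]
  by_cases hd : d = 0
  · simp [hd]
  · rw [if_neg fun h => hd (hw d h), if_neg (Ne.symm hd)]

theorem mem_span_range_freeProj {ι : Type*} [Finite ι] (s : ι → A) (f : ι → MvPolynomial σ K) :
    f ∈ Submodule.span (MvPolynomial σ K) (Set.range fun a => freeProj K w s a f) := by
  classical
  have := Fintype.ofFinite ι
  let T : Finset A := Finset.univ.biUnion fun j =>
    (f j).support.image fun d : σ →₀ ℕ => Finsupp.weight w d + s j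
  suffices hf : f = ∑ a ∈ T, freeProj K w s a f by
    have hmem : ∑ a ∈ T, freeProj K w s a f ∈
        Submodule.span (MvPolynomial σ K) (Set.range fun a => freeProj K w s a f) :=
      sum_mem fun a _ => Submodule.subset_span (Set.mem_range_self a)
    rwa [← hf] at hmem
  ext j d
  rw [Finset.sum_apply, coeff_sum]
  simp only [freeProj, AddMonoidHom.coe_mk, ZeroHom.coe_mk, coeff_weightedHomogeneousComponent,
    eq_sub_iff_add_eq]
  rw [Finset.sum_ite_eq]
  split_ifs with h
  · rfl
  · by_contra hne
    exact h (Finset.mem_biUnion.2 ⟨j, Finset.mem_univ _,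
      Finset.mem_image_of_mem _ (mem_support_iff.2 hne)⟩)

theorem GradingProj.span_homogeneous_ker (h : GradingProj (K := K) w 𝓜 p) {ι : Type*} [Finite ι]
    [DecidableEq ι] {s : ι → A} {l : (ι → MvPolynomial σ K) →ₗ[MvPolynomial σ K] M}
    (hl : ∀ j, l (Pi.single j 1) ∈ 𝓜 (s j)) :
    Submodule.span (MvPolynomial σ K) (↑(LinearMap.ker l) ∩ ⋃ a, freeDegree K w s a) =
      LinearMap.ker l := by
  have := Fintype.ofFinite ι
  refine le_antisymm (Submodule.span_le.2 Set.inter_subset_left) fun f hf => ?_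
  refine Submodule.span_mono ?_ (mem_span_range_freeProj (w := w) s f)
  rintro _ ⟨a, rfl⟩
  refine ⟨?_, Set.mem_iUnion_of_mem a ((gradingProj_free s).proj_mem a f)⟩
  rw [SetLike.mem_coe, LinearMap.mem_ker, ← h.proj_map hl, LinearMap.mem_ker.1 hf, map_zero]

theorem GradingProj.mem_span_of_map_eq_zero (h : GradingProj (K := K) w 𝓜 p)
    (hw : ∀ d : σ →₀ ℕ, Finsupp.weight w d = 0 → d = 0) {ι : Type*} [Finite ι] [DecidableEq ι]
    {s : ι → A} {l : (ι → MvPolynomial σ K) →ₗ[MvPolynomial σ K] M}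
    (hl : ∀ j, l (Pi.single j 1) ∈ 𝓜 (s j)) {f : ι → MvPolynomial σ K} (hf : l f = 0) {j : ι}
    (hj : f j ∉ idealOfVars σ K) :
    l (Pi.single j 1) ∈
      Submodule.span (MvPolynomial σ K) ((fun i => l (Pi.single i 1)) '' {j}ᶜ) := by
  have := Fintype.ofFinite ι
  have hunit : IsUnit (freeProj K w s (s j) f j) := by
    rw [mem_idealOfVars_iff] at hj
    simpa [freeProj, weightedHomogeneousComponent_zero_eq_C hw] using hj
  have hsum : l (freeProj K w s (s j) f) = 0 := by rw [← h.proj_map hl, hf, map_zero]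
  rw [map_eq_sum_smul_single l, ← Finset.add_sum_erase _ _ (Finset.mem_univ j)] at hsum
  rw [← Submodule.smul_mem_iff_of_isUnit _ hunit, eq_neg_of_add_eq_zero_left hsum]
  exact neg_mem (sum_mem fun i hi => Submodule.smul_mem _ _
    (Submodule.subset_span ⟨i, Finset.ne_of_mem_erase hi, rfl⟩))

theorem GradingProj.exists_minimal_cover (h : GradingProj (K := K) w 𝓜 p)
    (hw : ∀ d : σ →₀ ℕ, Finsupp.weight w d = 0 → d = 0) {N : Submodule (MvPolynomial σ K) M}
    (hN : N.FG) (hspan : Submodule.span (MvPolynomial σ K) (↑N ∩ ⋃ a, 𝓜 a) = N) :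
    ∃ (r : ℕ) (s : Fin r → A) (l : (Fin r → MvPolynomial σ K) →ₗ[MvPolynomial σ K] M),
      (∀ j, l (Pi.single j 1) ∈ 𝓜 (s j)) ∧ LinearMap.range l = N ∧
      ∀ f ∈ LinearMap.ker l, ∀ j, f j ∈ idealOfVars σ K := by
  obtain ⟨t, htN, ht, hirr⟩ := exists_irredundant_finset (R := MvPolynomial σ K) (by rwa [hspan])
  let m : Fin t.card → M := fun j => t.equivFin.symm j
  have hmt : Set.range m = t := by
    rw [Set.range_comp' Subtype.val, t.equivFin.symm.range_eq_univ, Set.image_univ,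
      Subtype.range_coe]
  have hm (j) : m j ∈ t := (t.equivFin.symm j).2
  choose s hs using fun j => Set.mem_iUnion.1 (htN (hm j)).2
  let l := Fintype.linearCombination (MvPolynomial σ K) m
  have hlm (j) : l (Pi.single j 1) = m j := by simp [l, Fintype.linearCombination_apply_single]
  have hl (j) : l (Pi.single j 1) ∈ 𝓜 (s j) := (hlm j).symm ▸ hs j
  refine ⟨t.card, s, l, hl, ?_, fun f hf j => ?_⟩
  · rw [Fintype.range_linearCombination, hmt, ht, hspan]
  by_contra hj
  refine hirr (m j) (hm j) (Submodule.span_mono ?_ (hlm j ▸ h.mem_span_of_map_eq_zero hw hl hf hj))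
  rintro _ ⟨i, hij, rfl⟩
  simp only [hlm]
  exact ⟨hm i, fun hmij => hij (t.equivFin.symm.injective (Subtype.ext hmij))⟩

theorem GradingProj.exists_isMinimal [Finite σ] [Module.Finite (MvPolynomial σ K) M]
    (h : GradingProj (K := K) w 𝓜 p) (hw : ∀ d : σ →₀ ℕ, Finsupp.weight w d = 0 → d = 0)
    (hspan : Submodule.span (MvPolynomial σ K) (⋃ a, 𝓜 a) = ⊤) :
    ∃ F : GradedFreeResolution (K := K) w 𝓜, F.IsMinimal := by
  obtain ⟨r, s, ε, hε, hεr, hεm⟩ :=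
    h.exists_minimal_cover hw Module.Finite.fg_top (by simpa using hspan)
  -- The terms are triples `(r, s, N)`, where `N` is the kernel of the map from `⨁_j R(-s j)`.
  obtain ⟨f, hf₀, hP, hR⟩ := exists_dependent_seq
    (α := fun _ => Σ r : ℕ, (Fin r → A) × Submodule (MvPolynomial σ K) (Fin r → MvPolynomial σ K))
    (P := fun _ Y =>
      Submodule.span (MvPolynomial σ K) (↑Y.2.2 ∩ ⋃ a, freeDegree K w Y.2.1 a) = Y.2.2 ∧
        ∀ f ∈ Y.2.2, ∀ j, f j ∈ idealOfVars σ K)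
    (R := fun _ Y Z => ∃ d : (Fin Z.1 → MvPolynomial σ K) →ₗ[MvPolynomial σ K]
        (Fin Y.1 → MvPolynomial σ K), (∀ j, d (Pi.single j 1) ∈ freeDegree K w Y.2.1 (Z.2.1 j)) ∧
      LinearMap.range d = Y.2.2 ∧ LinearMap.ker d = Z.2.2)
    (a₀ := ⟨r, s, LinearMap.ker ε⟩) ⟨h.span_homogeneous_ker hε, hεm⟩ fun _ ⟨r, s, N⟩ ⟨hN, _⟩ => by
      have hs := gradingProj_free (K := K) (w := w) s
      obtain ⟨r', s', l, hl, hlr, hlm⟩ := hs.exists_minimal_cover hw (IsNoetherian.noetherian N) hN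
      exact ⟨⟨r', s', LinearMap.ker l⟩, ⟨hs.span_homogeneous_ker hl, hlm⟩, l, hl, hlr, rfl⟩
  choose d hd hdr hdk using hR
  obtain ⟨ε, hε, hεr, hεk⟩ : ∃ ε : (Fin (f 0).1 → MvPolynomial σ K) →ₗ[MvPolynomial σ K] M,
      (∀ j, ε (Pi.single j 1) ∈ 𝓜 ((f 0).2.1 j)) ∧ LinearMap.range ε = ⊤ ∧
        LinearMap.ker ε = (f 0).2.2 := hf₀ ▸ ⟨ε, hε, hεr, rfl⟩
  exact ⟨{  rank := fun i => (f i).1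
            shift := fun i => (f i).2.1
            d := d
            ε := ε
            d_homogeneous := fun i j j' => hd i j j'
            ε_homogeneous := hε
            ε_surjective := LinearMap.range_eq_top.1 hεr
            exact_zero := LinearMap.exact_iff.2 (by rw [hεk, hdr])
            exact_succ := fun i => LinearMap.exact_iff.2 (by rw [hdk, hdr]) },
    fun i v j => (hP i).2 _ (hdr i ▸ LinearMap.mem_range_self _ v) j⟩

end Resolution

theorem exists_basis_lift {ι R L N : Type*} [Finite ι] [DecidableEq ι] [CommRing R]
    [AddCommGroup N] [Module R N] [AddCommGroup L] [Module R L] {e : N →ₗ[R] L}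
    {g : (ι → R) →ₗ[R] L} {T : ι → Set N} (h : ∀ j, ∃ z ∈ T j, e z = g (Pi.single j 1)) :
    ∃ φ : (ι → R) →ₗ[R] N, (∀ j, φ (Pi.single j 1) ∈ T j) ∧ e ∘ₗ φ = g := by
  have := Fintype.ofFinite ι
  choose y hy hyg using h
  refine ⟨Fintype.linearCombination R y, fun j => ?_, LinearMap.pi_ext' fun j => ?_⟩
  · simpa [Fintype.linearCombination_apply_single] using hy j
  · ext
    simp [Fintype.linearCombination_apply_single, hyg]

namespace GradedFreeResolution

variable {K σ A M : Type*} [Field K] [AddCommGroup A] {w : σ → A}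
  [AddCommGroup M] [Module (MvPolynomial σ K) M] {𝓜 : A → Set M}
  {F : GradedFreeResolution (K := K) w 𝓜}

theorem isResolution (F : GradedFreeResolution (K := K) w 𝓜) :
    IsResolution (F := fun i => Fin (F.rank i) → MvPolynomial σ K) F.d F.ε :=
  ⟨F.ε_surjective, F.exact_zero, F.exact_succ⟩

theorem exists_shift_zero_eq (F : GradedFreeResolution (K := K) w 𝓜) {p : A → M →+ M}
    (h : GradingProj (K := K) w 𝓜 p) {a : A} {m : M} (hm : m ∈ 𝓜 a)
    (hm' : m ∉ idealOfVars σ K • (⊤ : Submodule (MvPolynomial σ K) M)) :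
    ∃ j, F.shift 0 j = a := by
  by_contra! hne
  obtain ⟨z, hz, rfl⟩ := h.exists_homogeneous_preimage F.ε_homogeneous hm (F.ε_surjective m)
  refine hm' (map_mem_smul_top F.ε (mem_smul_top_pi_iff.2 fun j => ?_))
  rw [smul_eq_mul, Ideal.mul_top, mem_idealOfVars_iff]
  refine (hz j).coeff_eq_zero 0 ?_
  rw [map_zero]
  exact (sub_ne_zero.2 (hne j).symm).symm

variable {G : ℕ → Type*} [∀ i, AddCommGroup (G i)] [∀ i, Module (MvPolynomial σ K) (G i)]
  {N : Type*} [AddCommGroup N] [Module (MvPolynomial σ K) N]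
  {dG : ∀ i, G (i + 1) →ₗ[MvPolynomial σ K] G i} {εG : G 0 →ₗ[MvPolynomial σ K] N}
  {𝓖 : ∀ i, A → Set (G i)} {q : ∀ i, A → G i →+ G i}

theorem exists_homogeneous_lift (F : GradedFreeResolution (K := K) w 𝓜)
    (hG : IsResolution dG εG) (h𝓖 : ∀ i, GradingProj (K := K) w (𝓖 i) (q i))
    (f : M →ₗ[MvPolynomial σ K] N) (h₀ : ∀ a, ∀ m ∈ 𝓜 a, ∃ z ∈ 𝓖 0 a, εG z = f m)
    (hd : ∀ i a, ∀ y ∈ 𝓖 i a, y ∈ Set.range (dG i) → ∃ z ∈ 𝓖 (i + 1) a, dG i z = y) :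
    ∃ φ : ∀ i, (Fin (F.rank i) → MvPolynomial σ K) →ₗ[MvPolynomial σ K] G i,
      (∀ i j, φ i (Pi.single j 1) ∈ 𝓖 i (F.shift i j)) ∧ εG ∘ₗ φ 0 = f ∘ₗ F.ε ∧
        ∀ i, dG i ∘ₗ φ (i + 1) = φ i ∘ₗ F.d i := by
  obtain ⟨φ₀, hφ₀, hεφ⟩ := exists_basis_lift (e := εG) (g := f ∘ₗ F.ε)
    (T := fun j => 𝓖 0 (F.shift 0 j)) fun j => h₀ _ _ (F.ε_homogeneous j)
  obtain ⟨φ, rfl, hφ, hdφ⟩ := exists_dependent_seq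
    (α := fun i => (Fin (F.rank i) → MvPolynomial σ K) →ₗ[MvPolynomial σ K] G i)
    (P := fun i φ => (∀ j, φ (Pi.single j 1) ∈ 𝓖 i (F.shift i j)) ∧
      LinearMap.range (φ ∘ₗ F.d i) ≤ LinearMap.range (dG i))
    (R := fun i φ φ' => dG i ∘ₗ φ' = φ ∘ₗ F.d i) (a₀ := φ₀)
    ⟨hφ₀, range_le_range_of_comp_eq_zero hG.exact_zero (by
      rw [← LinearMap.comp_assoc, hεφ, LinearMap.comp_assoc,
        F.exact_zero.linearMap_comp_eq_zero, LinearMap.comp_zero])⟩ fun i φ ⟨hφ, hφd⟩ => by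
    obtain ⟨φ', hφ', hdφ'⟩ := exists_basis_lift (e := dG i) (g := φ ∘ₗ F.d i)
      (T := fun j => 𝓖 (i + 1) (F.shift (i + 1) j)) fun j =>
      hd _ _ _ ((h𝓖 i).map_mem hφ (F.d_homogeneous i j)) (hφd ⟨Pi.single j 1, rfl⟩)
    refine ⟨φ', ⟨hφ', range_le_range_of_comp_eq_zero (hG.exact_succ i) ?_⟩, hdφ'⟩
    rw [← LinearMap.comp_assoc, hdφ', LinearMap.comp_assoc,
      (F.exact_succ i).linearMap_comp_eq_zero, LinearMap.comp_zero]
  exact ⟨φ, fun i => (hφ i).1, hεφ, hdφ⟩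

theorem IsMinimal.exists_notMem [∀ i, Module.Projective (MvPolynomial σ K) (G i)]
    (hF : F.IsMinimal) (hG : IsResolution dG εG) (h𝓖 : ∀ i, GradingProj (K := K) w (𝓖 i) (q i))
    {f : M →ₗ[MvPolynomial σ K] N} {r : N →ₗ[MvPolynomial σ K] M} (hr : r ∘ₗ f = LinearMap.id)
    (h₀ : ∀ a, ∀ m ∈ 𝓜 a, ∃ z ∈ 𝓖 0 a, εG z = f m)
    (hd : ∀ i a, ∀ y ∈ 𝓖 i a, y ∈ Set.range (dG i) → ∃ z ∈ 𝓖 (i + 1) a, dG i z = y)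
    (i : ℕ) (j : Fin (F.rank i)) :
    ∃ y ∈ 𝓖 i (F.shift i j), y ∉ idealOfVars σ K • (⊤ : Submodule (MvPolynomial σ K) (G i)) := by
  obtain ⟨φ, hφ, hεφ, hdφ⟩ := F.exists_homogeneous_lift hG h𝓖 f h₀ hd
  refine ⟨φ i (Pi.single j 1), hφ i j, fun hmem => ?_⟩
  have hmin (i v) : F.d i v ∈ idealOfVars σ K • (⊤ : Submodule (MvPolynomial σ K) _) :=
    mem_smul_top_pi_iff.2 fun j => by simpa using hF i v j
  have hj := mem_smul_top_pi_iff.1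
    (F.isResolution.mem_smul_top_of_lift_mem hG hmin hr hεφ hdφ hmem) j
  rw [smul_eq_mul, Ideal.mul_top, mem_idealOfVars_iff] at hj
  simp at hj

theorem IsMinimal.rank_eq_zero [Subsingleton M] (hF : F.IsMinimal) (i : ℕ) : F.rank i = 0 := by
  by_contra hi
  obtain ⟨y, -, hy⟩ := hF.exists_notMem (G := fun _ => PUnit) (N := M) (dG := fun _ => 0)
    (εG := 0) (𝓖 := fun _ _ => Set.univ) (q := fun _ _ => 0) (f := LinearMap.id)
    (r := LinearMap.id)
    ⟨fun m => ⟨0, Subsingleton.elim _ _⟩, fun y => by simp, fun _ y => by simp⟩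
    (fun _ => ⟨fun _ _ => trivial, fun _ => rfl, fun _ _ => rfl, fun _ _ => trivial⟩) rfl
    (fun _ m _ => ⟨0, trivial, Subsingleton.elim _ _⟩) (fun _ _ y _ _ => ⟨0, trivial, rfl⟩)
    i ⟨0, Nat.pos_of_ne_zero hi⟩
  exact hy (Submodule.zero_mem _)

theorem IsMinimal.shift_mem (hF : F.IsMinimal) {C : AddSubmonoid A} (hw : ∀ s, w s ∈ C)
    (h𝓜 : ∀ a ∉ C, 𝓜 a ⊆ {0}) (i : ℕ) (j : Fin (F.rank i)) : F.shift i j ∈ C := by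
  have hrange (i) (j : Fin (F.rank i)) :
      (Pi.single j 1 : Fin (F.rank i) → MvPolynomial σ K) ∉ Set.range (F.d i) := by
    rintro ⟨v, hv⟩
    have hj := mem_idealOfVars_iff.1 (hF i v j)
    simp [hv] at hj
  induction i with
  | zero =>
    by_contra hj
    exact hrange 0 j ((F.exact_zero _).1 (h𝓜 _ hj (F.ε_homogeneous j)))
  | succ i ih =>
    by_contra hj
    refine hrange (i + 1) j ((F.exact_succ i _).1 (funext fun l => ?_))
    refine (F.d_homogeneous i j l).eq_zero_of_no_monomials fun d hd => hj ?_
    rw [← sub_add_cancel (F.shift (i + 1) j) (F.shift i l), ← hd, Finsupp.weight_apply]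
    exact add_mem (sum_mem fun s _ => nsmul_mem (hw s) _) (ih l)

end GradedFreeResolution

/-! ## Homogeneous ideals and their regularity -/

section Regularity

attribute [local instance] MvPolynomial.gradedAlgebra

variable {K : Type*} [Field K] {n : ℕ} {J J' : Ideal (MvPolynomial (Fin n) K)}

theorem weight_one_int {σ : Type*} (d : σ →₀ ℕ) :
    Finsupp.weight (fun _ : σ => (1 : ℤ)) d = d.degree := by
  simp [Finsupp.weight_apply, Finsupp.sum, Finsupp.degree_apply]

theorem isHomogeneous_iff {σ R : Type*} [CommSemiring R] {f : MvPolynomial σ R} {d : ℕ} :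
    f.IsHomogeneous d ↔ ∀ a ∈ f.support, a.degree = d := by
  simp only [IsHomogeneous, IsWeightedHomogeneous, mem_support_iff, Finsupp.degree_eq_weight_one]
  rfl

theorem isHomogeneous_iff_int {σ R : Type*} [CommSemiring R] {f : MvPolynomial σ R} {d : ℕ} :
    f.IsHomogeneous d ↔ IsWeightedHomogeneous (fun _ : σ => (1 : ℤ)) f d := by
  simp only [isHomogeneous_iff, IsWeightedHomogeneous, mem_support_iff, weight_one_int,
    Nat.cast_inj]

theorem isHomogeneous_toNat {σ R : Type*} [CommSemiring R] {f : MvPolynomial σ R} {c : ℤ}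
    (hf : IsWeightedHomogeneous (fun _ : σ => (1 : ℤ)) f c) : f.IsHomogeneous c.toNat :=
  isHomogeneous_iff.2 fun a ha => by
    rw [← hf (mem_support_iff.1 ha), weight_one_int, Int.toNat_natCast]

theorem isWeightedHomogeneous_homogeneousComponent {σ R : Type*} [CommSemiring R] (d : ℕ)
    (f : MvPolynomial σ R) :
    IsWeightedHomogeneous (fun _ : σ => (1 : ℤ)) (homogeneousComponent d f) d :=
  isHomogeneous_iff_int.1 (homogeneousComponent_isHomogeneous d f)

theorem weightedHomogeneousComponent_mem (hJ : J.IsHomogeneous (homogeneousSubmodule (Fin n) K))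
    {f : MvPolynomial (Fin n) K} (hf : f ∈ J) (a : ℤ) :
    weightedHomogeneousComponent (fun _ : Fin n => (1 : ℤ)) a f ∈ J := by
  classical
  rw [← sum_homogeneousComponent f, map_sum]
  refine sum_mem fun d _ => ?_
  rw [weightedHomogeneousComponent_of_mem (isWeightedHomogeneous_homogeneousComponent d f)]
  split_ifs
  exacts [homogeneousComponent_mem_of_mem hJ hf d, zero_mem J]

/-- The homogeneous component of degree `a` of the elements of a homogeneous ideal `J`. -/
def idealProj (hJ : J.IsHomogeneous (homogeneousSubmodule (Fin n) K)) (a : ℤ) : J →+ J where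
  toFun f := ⟨weightedHomogeneousComponent (fun _ => 1) a f.1,
    weightedHomogeneousComponent_mem hJ f.2 a⟩
  map_zero' := by ext; simp
  map_add' f g := by ext; simp

theorem gradingProj_ideal (hJ : J.IsHomogeneous (homogeneousSubmodule (Fin n) K)) :
    GradingProj (K := K) (fun _ : Fin n => (1 : ℤ)) (idealDegree J) (idealProj hJ) where
  smul_mem hf hm := hf.mul hm
  proj_of_mem hm := Subtype.ext <| by classical exact hm.weightedHomogeneousComponent_same
  proj_of_ne hm hab := Subtype.ext <| by
    classical exact hm.weightedHomogeneousComponent_ne _ hab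
  proj_mem a f := weightedHomogeneousComponent_isWeightedHomogeneous a f.1

theorem span_idealDegree (hJ : J.IsHomogeneous (homogeneousSubmodule (Fin n) K)) :
    Submodule.span (MvPolynomial (Fin n) K) (⋃ a, idealDegree J a) = ⊤ := by
  refine eq_top_iff.2 fun f _ => ?_
  have hf : f = ∑ d ∈ Finset.range (f.1.totalDegree + 1),
      (⟨homogeneousComponent d f.1, homogeneousComponent_mem_of_mem hJ f.2 d⟩ : J) :=
    Subtype.ext (by rw [AddSubmonoidClass.coe_finsetSum, sum_homogeneousComponent])
  rw [hf]
  exact sum_mem fun d _ => Submodule.subset_span <|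
    Set.mem_iUnion_of_mem (d : ℤ) (isWeightedHomogeneous_homogeneousComponent d f.1)

theorem exists_isMinimal_idealDegree (hJ : J.IsHomogeneous (homogeneousSubmodule (Fin n) K)) :
    ∃ F : GradedFreeResolution (K := K) (fun _ : Fin n => (1 : ℤ)) (idealDegree J),
      F.IsMinimal :=
  (gradingProj_ideal hJ).exists_isMinimal
    (fun d hd => (Finsupp.degree_eq_zero_iff d).1 (by exact_mod_cast weight_one_int d ▸ hd))
    (span_idealDegree hJ)

theorem mem_idealShifts_zero (hJ : J.IsHomogeneous (homogeneousSubmodule (Fin n) K))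
    {f : MvPolynomial (Fin n) K} (hfJ : f ∈ J) {d : ℕ} (hf : f.IsHomogeneous d)
    (hfm : f ∉ idealOfVars (Fin n) K * J) : (d : ℤ) ∈ idealShifts J 0 := by
  obtain ⟨F, hF⟩ := exists_isMinimal_idealDegree hJ
  exact ⟨F, hF, F.exists_shift_zero_eq (gradingProj_ideal hJ) (m := ⟨f, hfJ⟩)
    (isHomogeneous_iff_int.1 hf) fun h => hfm ((Submodule.mem_smul_top_iff _ _ _).1 h)⟩

theorem le_reg {i : ℕ} {a : ℤ} (ha : a ∈ idealShifts J i) :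
    (((a - i : ℤ) : ℝ) : EReal) ≤ reg J :=
  le_iSup_of_le i (le_iSup₂_of_le a ha le_rfl)

theorem reg_le {c : EReal} (h : ∀ i, ∀ a ∈ idealShifts J i, (((a - i : ℤ) : ℝ) : EReal) ≤ c) :
    reg J ≤ c :=
  iSup_le fun i => iSup₂_le fun a ha => h i a ha

theorem le_finalDegree {f : MvPolynomial (Fin n) K} (hfJ : f ∈ J) {d : ℕ} (hf : f.IsHomogeneous d)
    (hfm : f ∉ idealOfVars (Fin n) K * J) : (d : EReal) ≤ finalDegree J :=
  le_iSup₂_of_le d ⟨f, hfJ, hf, hfm⟩ le_rfl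

theorem finalDegree_le_reg (hJ : J.IsHomogeneous (homogeneousSubmodule (Fin n) K)) :
    finalDegree J ≤ reg J := by
  refine iSup₂_le ?_
  rintro d ⟨f, hfJ, hf, hfm⟩
  simpa using le_reg (mem_idealShifts_zero hJ hfJ hf hfm)

theorem reg_bot : reg (⊥ : Ideal (MvPolynomial (Fin n) K)) = ⊥ := by
  refine le_bot_iff.1 (reg_le ?_)
  rintro i _ ⟨F, hF, j, -⟩
  exact (hF.rank_eq_zero i ▸ j).elim0

theorem finalDegree_bot : finalDegree (⊥ : Ideal (MvPolynomial (Fin n) K)) = ⊥ := by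
  refine le_bot_iff.1 (iSup₂_le ?_)
  rintro d ⟨f, rfl, -, hf⟩
  exact absurd (zero_mem _) hf

/-- `J` is generated by homogeneous polynomials of degree `d`. -/
def IsGeneratedInDegree (J : Ideal (MvPolynomial (Fin n) K)) (d : ℕ) : Prop :=
  ∃ B : Set (MvPolynomial (Fin n) K), (∀ f ∈ B, f.IsHomogeneous d) ∧ J = Ideal.span B

open Pointwise in
theorem IsGeneratedInDegree.mul {d d' : ℕ} (hJ : IsGeneratedInDegree J d)
    (hJ' : IsGeneratedInDegree J' d') : IsGeneratedInDegree (J * J') (d + d') := by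
  obtain ⟨B, hB, rfl⟩ := hJ
  obtain ⟨B', hB', rfl⟩ := hJ'
  refine ⟨B * B', ?_, Ideal.span_mul_span' _ _⟩
  rintro _ ⟨f, hf, g, hg, rfl⟩
  exact (hB f hf).mul (hB' g hg)

theorem IsGeneratedInDegree.pow {d : ℕ} (hJ : IsGeneratedInDegree J d) (k : ℕ) :
    IsGeneratedInDegree (J ^ k) (d * k) := by
  induction k with
  | zero => exact ⟨{1}, fun f hf => hf ▸ isHomogeneous_one _ _, by simp⟩
  | succ k ih => simpa only [pow_succ, mul_add, mul_one] using ih.mul hJ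

theorem IsGeneratedInDegree.isHomogeneous {d : ℕ} (hJ : IsGeneratedInDegree J d) :
    J.IsHomogeneous (homogeneousSubmodule (Fin n) K) := by
  obtain ⟨B, hB, rfl⟩ := hJ
  exact Ideal.homogeneous_span _ B fun f hf => ⟨d, hB f hf⟩

theorem IsGeneratedInDegree.exists_notMem {d : ℕ} (hJ : IsGeneratedInDegree J d) (h0 : J ≠ ⊥) :
    ∃ f ∈ J, f.IsHomogeneous d ∧ f ∉ idealOfVars (Fin n) K * J := by
  obtain ⟨B, hB, rfl⟩ := hJ
  obtain ⟨f, hfB, hf⟩ : ∃ f ∈ B, f ≠ 0 := by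
    by_contra! h
    exact h0 (Ideal.span_eq_bot.2 h)
  refine ⟨f, Ideal.subset_span hfB, hB f hfB, fun hmem => ?_⟩
  have hle : Ideal.span B ≤ idealOfVars (Fin n) K ^ d := Ideal.span_le.2 fun g hg =>
    (mem_pow_idealOfVars_iff d g).2 fun a ha => (isHomogeneous_iff.1 (hB g hg) a ha).ge
  have hfd : f ∈ idealOfVars (Fin n) K ^ (d + 1) :=
    pow_succ' (idealOfVars (Fin n) K) d ▸ Ideal.mul_mono_right hle hmem
  obtain ⟨a, ha⟩ := support_nonempty.2 hf
  have hda := (mem_pow_idealOfVars_iff _ _).1 hfd a ha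
  rw [isHomogeneous_iff.1 (hB f hfB) a ha] at hda
  exact d.lt_irrefl hda

theorem IsGeneratedInDegree.reg_eq {d : ℕ} (hJ : IsGeneratedInDegree J d)
    (hlin : HasLinearResolution J) (h0 : J ≠ ⊥) :
    reg J = (d : EReal) ∧ finalDegree J = (d : EReal) := by
  obtain ⟨c, hc⟩ := hlin
  obtain ⟨f, hfJ, hf, hfm⟩ := hJ.exists_notMem h0
  have hcd : c = d := by
    simpa using (hc 0 _ (mem_idealShifts_zero hJ.isHomogeneous hfJ hf hfm)).symm
  have hreg : reg J ≤ (d : EReal) := reg_le fun i a ha => by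
    rw [hc i a ha, hcd]
    simp
  have hfin : finalDegree J ≤ reg J := finalDegree_le_reg hJ.isHomogeneous
  have hd : (d : EReal) ≤ finalDegree J := le_finalDegree hfJ hf hfm
  exact ⟨hreg.antisymm (hd.trans hfin), (hfin.trans hreg).antisymm hd⟩

theorem HasLinearResolution.exists_isGeneratedInDegree (hlin : HasLinearResolution J)
    (hJ : J.IsHomogeneous (homogeneousSubmodule (Fin n) K)) : ∃ d, IsGeneratedInDegree J d := by
  obtain ⟨c, hc⟩ := hlin
  obtain ⟨F, hF⟩ := exists_isMinimal_idealDegree hJ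
  refine ⟨c.toNat, Set.range fun j => (F.ε (Pi.single j 1)).1, ?_, ?_⟩
  · rintro _ ⟨j, rfl⟩
    have hj : F.shift 0 j = c := by simpa using hc 0 _ ⟨F, hF, j, rfl⟩
    exact isHomogeneous_toNat (hj ▸ F.ε_homogeneous j)
  · refine le_antisymm (fun f hf => ?_) (Ideal.span_le.2 ?_)
    · obtain ⟨z, hz⟩ := F.ε_surjective ⟨f, hf⟩
      obtain rfl : J.subtype (F.ε z) = f := congrArg Subtype.val hz
      rw [map_eq_sum_smul_single F.ε z, map_sum]
      exact sum_mem fun j _ => Ideal.mul_mem_left _ _ (Ideal.subset_span ⟨j, rfl⟩)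
    · rintro _ ⟨j, rfl⟩
      exact Subtype.mem _

theorem HasLinearPowers.reg_pow (hlin : HasLinearPowers J)
    (hJ : J.IsHomogeneous (homogeneousSubmodule (Fin n) K)) {k : ℕ} (hk : 1 ≤ k) :
    reg (J ^ k) = finalDegree J * (k : EReal) := by
  rcases eq_or_ne J ⊥ with rfl | h0
  · rw [Ideal.bot_pow (by lia), reg_bot, finalDegree_bot,
      EReal.bot_mul_of_pos (by exact_mod_cast hk)]
  have hlin₁ : HasLinearResolution J := by simpa using hlin 1 le_rfl
  obtain ⟨d, hd⟩ := hlin₁.exists_isGeneratedInDegree hJ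
  rw [(hd.reg_eq hlin₁ h0).2, ((hd.pow k).reg_eq (hlin k hk) (pow_ne_zero k h0)).1]
  norm_cast

end Regularity

/-! ## Monomial ideals -/

section Monomial

theorem exists_mem_support_mul {σ R Γ : Type*} [CommRing R] [NoZeroDivisors R] [AddCommMonoid Γ]
    [PartialOrder Γ] [IsOrderedCancelAddMonoid Γ] [CanonicallyOrderedAdd Γ] {w : σ → Γ}
    {s f : MvPolynomial σ R} (hs : weightedHomogeneousComponent w 0 s ≠ 0) {a : σ →₀ ℕ}
    (ha : a ∈ f.support) : ∃ d ∈ (s * f).support, Finsupp.weight w d ≤ Finsupp.weight w a := by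
  classical
  -- The component of `s * f` whose degree is a minimal weight of `f` is a product of components.
  obtain ⟨m, hma, hm⟩ := (f.support.image (Finsupp.weight w)).exists_le_minimal
    (Finset.mem_image_of_mem _ ha)
  obtain ⟨c, hc, rfl⟩ := Finset.mem_image.1 hm.prop
  have hf : weightedHomogeneousComponent w (Finsupp.weight w c) f ≠ 0 := fun h => by
    have hcf := congrArg (coeff c) h
    rw [coeff_weightedHomogeneousComponent, if_pos rfl, coeff_zero] at hcf
    exact mem_support_iff.1 hc hcf
  obtain ⟨d, hd⟩ := support_nonempty.2 (mul_ne_zero hs hf)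
  have hdc : Finsupp.weight w d = Finsupp.weight w c := by
    simpa using ((weightedHomogeneousComponent_isWeightedHomogeneous 0 s).mul
      (weightedHomogeneousComponent_isWeightedHomogeneous _ f)) (mem_support_iff.1 hd)
  refine ⟨d, ?_, hdc.trans_le hma⟩
  rw [mem_support_iff, coeff_mul] at hd ⊢
  refine ne_of_eq_of_ne (Finset.sum_congr rfl fun x hx => ?_) hd
  rw [coeff_weightedHomogeneousComponent, coeff_weightedHomogeneousComponent]
  by_cases hxf : x.2 ∈ f.support
  · have hx' : Finsupp.weight w x.1 + Finsupp.weight w x.2 = Finsupp.weight w c := by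
      rw [← map_add, Finset.HasAntidiagonal.mem_antidiagonal.1 hx, hdc]
    have hxc : Finsupp.weight w x.2 = Finsupp.weight w c :=
      hm.eq_of_le (Finset.mem_image_of_mem _ hxf) (hx' ▸ le_add_self)
    rw [if_pos hxc, if_pos (by simpa [hxc] using hx')]
  · simp [notMem_support_iff.1 hxf]

theorem mem_of_forall_monomial_mem {σ R : Type*} [CommSemiring R] {J : Ideal (MvPolynomial σ R)}
    {f : MvPolynomial σ R} (h : ∀ a ∈ f.support, monomial a (1 : R) ∈ J) : f ∈ J := by
  rw [f.as_sum]
  refine sum_mem fun a ha => ?_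
  rw [← mul_one (coeff a f), ← C_mul_monomial]
  exact J.mul_mem_left _ (h a ha)

theorem monomial_mem_iff_of_isPrime {σ R : Type*} [CommSemiring R] {P : Ideal (MvPolynomial σ R)}
    (hP : P.IsPrime) {a : σ →₀ ℕ} : monomial a (1 : R) ∈ P ↔ ∃ i ∈ a.support, X i ∈ P := by
  rw [monomial_eq, C_1, one_mul, Finsupp.prod, hP.prod_mem_iff]
  exact exists_congr fun i => and_congr_right fun hi =>
    hP.pow_mem_iff_mem _ (Nat.pos_of_ne_zero (Finsupp.mem_support_iff.1 hi))

variable {K : Type*} [Field K] {n : ℕ} {I J P : Ideal (MvPolynomial (Fin n) K)}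

theorem isMonomialIdeal_iff :
    IsMonomialIdeal J ↔ ∀ f ∈ J, ∀ a ∈ f.support, monomial a (1 : K) ∈ J := by
  constructor
  · rintro ⟨E, rfl⟩ f hf a ha
    obtain ⟨b, hb, hba⟩ := mem_ideal_span_monomial_image.1 hf a ha
    exact Ideal.mem_of_dvd _ (monomial_dvd_monomial.2 ⟨Or.inr hba, dvd_rfl⟩)
      (Ideal.subset_span ⟨b, hb, rfl⟩)
  · intro h
    refine ⟨{a | monomial a (1 : K) ∈ J}, le_antisymm (fun f hf => ?_) (Ideal.span_le.2 ?_)⟩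
    · exact mem_ideal_span_monomial_image.2 fun a ha => ⟨a, h f hf a ha, le_rfl⟩
    · rintro _ ⟨a, ha, rfl⟩
      exact ha

open Pointwise in
theorem IsMonomialIdeal.mul (hI : IsMonomialIdeal I) (hJ : IsMonomialIdeal J) :
    IsMonomialIdeal (I * J) := by
  obtain ⟨E, rfl⟩ := hI
  obtain ⟨E', rfl⟩ := hJ
  refine ⟨E + E', ?_⟩
  rw [Ideal.span_mul_span']
  congr 1
  ext f
  simp [Set.mem_mul, Set.mem_add, monomial_mul]

theorem IsMonomialIdeal.pow (hJ : IsMonomialIdeal J) (k : ℕ) : IsMonomialIdeal (J ^ k) := by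
  induction k with
  | zero => exact ⟨{0}, by simp⟩
  | succ k ih => exact pow_succ J k ▸ ih.mul hJ

theorem isMonomialIdeal_iInf {ι : Sort*} {J : ι → Ideal (MvPolynomial (Fin n) K)}
    (hJ : ∀ i, IsMonomialIdeal (J i)) : IsMonomialIdeal (⨅ i, J i) :=
  isMonomialIdeal_iff.2 fun f hf a ha => Ideal.mem_iInf.2 fun i =>
    isMonomialIdeal_iff.1 (hJ i) f (Ideal.mem_iInf.1 hf i) a ha

attribute [local instance] MvPolynomial.gradedAlgebra in
theorem IsMonomialIdeal.isHomogeneous (hJ : IsMonomialIdeal J) :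
    J.IsHomogeneous (homogeneousSubmodule (Fin n) K) := by
  obtain ⟨E, rfl⟩ := hJ
  refine Ideal.homogeneous_span _ _ ?_
  rintro _ ⟨a, -, rfl⟩
  exact ⟨a.degree, isHomogeneous_monomial 1 rfl⟩

theorem IsMonomialIdeal.exists_monomial_mul_mem (hJ : IsMonomialIdeal J) (hP : P.IsPrime)
    {s f : MvPolynomial (Fin n) K} (hs : s ∉ P) (hsf : s * f ∈ J) {a : Fin n →₀ ℕ}
    (ha : a ∈ f.support) :
    ∃ b, monomial b (1 : K) ∉ P ∧ monomial b 1 * monomial a 1 ∈ J := by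
  classical
  -- The weight of an exponent is its part in the variables contained in `P`.
  let w (i : Fin n) : Fin n →₀ ℕ := if X i ∈ P then Finsupp.single i 1 else 0
  have hw (d : Fin n →₀ ℕ) : Finsupp.weight w d = d.filter (X · ∈ P) := by
    induction d using Finsupp.induction_linear with
    | zero => rw [map_zero, Finsupp.filter_zero]
    | add d d' hd hd' => rw [map_add, hd, hd', Finsupp.filter_add]
    | single i m =>
      by_cases hi : X i ∈ P
      · rw [Finsupp.filter_single_of_pos (X · ∈ P) hi, Finsupp.weight_single]
        simp [w, hi]
      · rw [Finsupp.filter_single_of_neg (X · ∈ P) hi, Finsupp.weight_single]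
        simp [w, hi]
  have hs₀ : weightedHomogeneousComponent w 0 s ≠ 0 := fun h => by
    refine hs (mem_of_forall_monomial_mem fun c hc => (monomial_mem_iff_of_isPrime hP).2 ?_)
    by_contra! hcP
    refine mem_support_iff.1 hc ?_
    have hwc : Finsupp.weight w c = 0 :=
      (hw c).trans ((Finsupp.filter_eq_zero_iff _ _).2 fun i hi => by
        by_contra hci
        exact hcP i (Finsupp.mem_support_iff.2 hci) hi)
    have hcs := congrArg (coeff c) h
    rwa [coeff_weightedHomogeneousComponent, if_pos hwc, coeff_zero] at hcs
  obtain ⟨d, hd, hda⟩ := exists_mem_support_mul hs₀ ha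
  rw [hw, hw] at hda
  refine ⟨d.filter (X · ∉ P), fun h => ?_, ?_⟩
  · obtain ⟨i, hi, hiP⟩ := (monomial_mem_iff_of_isPrime hP).1 h
    rw [Finsupp.support_filter, Finset.mem_filter] at hi
    exact hi.2 hiP
  · have hle : d ≤ d.filter (X · ∉ P) + a := by
      conv_lhs => rw [← Finsupp.filter_add_filter_not d (X · ∈ P), add_comm]
      gcongr
      exact hda.trans fun i => by rw [Finsupp.filter_apply]; split_ifs <;> simp
    rw [monomial_mul, one_mul]
    exact Ideal.mem_of_dvd _ (monomial_dvd_monomial.2 ⟨Or.inr hle, dvd_rfl⟩)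
      (isMonomialIdeal_iff.1 hJ _ hsf d hd)

open Pointwise in
theorem IsMonomialIdeal.monomial_mem_idealOfVars_mul_iff (hJ : IsMonomialIdeal J)
    {a : Fin n →₀ ℕ} :
    monomial a (1 : K) ∈ idealOfVars (Fin n) K * J ↔ ∃ b < a, monomial b (1 : K) ∈ J := by
  classical
  constructor
  · obtain ⟨E, rfl⟩ := hJ
    intro h
    rw [idealOfVars, Ideal.span_mul_span'] at h
    have hE : Set.range X * (fun a => monomial a (1 : K)) '' E =
        (fun a => monomial a 1) '' (Set.range (fun i => Finsupp.single i 1) + E) := by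
      ext f
      simp [Set.mem_mul, Set.mem_add, X, monomial_mul]
    rw [hE] at h
    obtain ⟨_, ⟨_, ⟨i, rfl⟩, b, hb, rfl⟩, hba⟩ := mem_ideal_span_monomial_image.1 h a (by simp)
    exact ⟨b, (lt_add_of_pos_left b (by simp [pos_iff_ne_zero])).trans_le hba,
      Ideal.subset_span ⟨b, hb, rfl⟩⟩
  · rintro ⟨b, hba, hb⟩
    obtain ⟨c, rfl⟩ := exists_add_of_le hba.le
    have hc : c ≠ 0 := by
      rintro rfl
      simp at hba
    rw [add_comm, ← one_mul (1 : K), ← monomial_mul]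
    exact Ideal.mul_mem_mul (mem_idealOfVars_iff.2 (by rw [coeff_monomial, if_neg hc])) hb

theorem IsMonomialIdeal.monomial_mem_minimalGenerators_iff (hJ : IsMonomialIdeal J)
    {a : Fin n →₀ ℕ} : monomial a (1 : K) ∈ minimalGenerators J ↔
      monomial a 1 ∈ J ∧ monomial a 1 ∉ idealOfVars (Fin n) K * J := by
  rw [hJ.monomial_mem_idealOfVars_mul_iff]
  push Not
  constructor
  · rintro ⟨a', ha', ha, hmin⟩
    obtain rfl : a = a' := monomial_left_injective one_ne_zero ha'
    exact ⟨ha, fun b hba hb => hba.ne (hmin b hb hba.le)⟩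
  · rintro ⟨ha, hmin⟩
    exact ⟨a, rfl, ha, fun b hb hba => by_contra fun hne => hmin b (hba.lt_of_ne hne) hb⟩

theorem IsMonomialIdeal.finalDegree_eq (hJ : IsMonomialIdeal J) :
    finalDegree J = ⨆ a ∈ {a | monomial a (1 : K) ∈ minimalGenerators J}, (a.degree : EReal) := by
  refine le_antisymm (iSup₂_le ?_) (iSup₂_le fun a ha => ?_)
  · rintro d ⟨f, hfJ, hf, hfm⟩
    obtain ⟨a, ha, ham⟩ : ∃ a ∈ f.support, monomial a (1 : K) ∉ idealOfVars (Fin n) K * J := by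
      by_contra! h
      exact hfm (mem_of_forall_monomial_mem h)
    rw [← isHomogeneous_iff.1 hf a ha]
    exact le_iSup₂_of_le a (hJ.monomial_mem_minimalGenerators_iff.2
      ⟨isMonomialIdeal_iff.1 hJ f hfJ a ha, ham⟩) le_rfl
  · obtain ⟨haJ, ham⟩ := hJ.monomial_mem_minimalGenerators_iff.1 ha
    exact le_finalDegree haJ (isHomogeneous_monomial 1 rfl) ham

open Classical in
/-- The weights of the `P`-adic order: the variables contained in `P` have weight `1`, the others
weight `0`. -/
def primeWeight (P : Ideal (MvPolynomial (Fin n) K)) (i : Fin n) : ℕ :=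
  if X i ∈ P then 1 else 0

theorem monomial_mem_pow_weight (P : Ideal (MvPolynomial (Fin n) K)) (a : Fin n →₀ ℕ) :
    monomial a (1 : K) ∈ P ^ Finsupp.weight (primeWeight P) a := by
  induction a using Finsupp.induction_linear with
  | zero => simp
  | add a b ha hb =>
    rw [map_add, pow_add, ← one_mul (1 : K), ← monomial_mul]
    exact Ideal.mul_mem_mul ha hb
  | single i m =>
    rw [Finsupp.weight_single, primeWeight, ← X_pow_eq_monomial]
    split_ifs with h
    · simpa using Ideal.pow_mem_pow h m
    · simp

theorem IsMonomialIdeal.one_le_weight (hM : IsMonomialIdeal P) (hP : P.IsPrime)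
    {f : MvPolynomial (Fin n) K} (hf : f ∈ P) {a : Fin n →₀ ℕ} (ha : a ∈ f.support) :
    1 ≤ Finsupp.weight (primeWeight P) a := by
  obtain ⟨i, hi, hiP⟩ :=
    (monomial_mem_iff_of_isPrime hP).1 (isMonomialIdeal_iff.1 hM f hf a ha)
  have hw : primeWeight P i = 1 := if_pos hiP
  exact hw.ge.trans (Finsupp.le_weight_of_ne_zero' _ (Finsupp.mem_support_iff.1 hi))

theorem IsMonomialIdeal.mem_pow_iff (hM : IsMonomialIdeal P) (hP : P.IsPrime) {e : ℕ}
    {f : MvPolynomial (Fin n) K} :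
    f ∈ P ^ e ↔ ∀ a ∈ f.support, e ≤ Finsupp.weight (primeWeight P) a := by
  classical
  refine ⟨fun hf => ?_, fun hf => mem_of_forall_monomial_mem fun a ha =>
    Ideal.pow_le_pow_right (hf a ha) (monomial_mem_pow_weight P a)⟩
  induction e generalizing f with
  | zero => simp
  | succ e ih =>
    rw [pow_succ] at hf
    induction hf using Submodule.mul_induction_on' with
    | mem_mul_mem g hg h hh =>
      intro a ha
      obtain ⟨b, hb, c, hc, rfl⟩ := Finset.mem_add.1 (support_mul _ _ ha)
      rw [map_add]
      exact add_le_add (ih hg b hb) (hM.one_le_weight hP hh hc)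
    | add g _ h _ hg hh =>
      intro a ha
      rcases Finset.mem_union.1 (support_add ha) with ha | ha
      exacts [hg a ha, hh a ha]

theorem IsMonomialIdeal.monomial_mem_pow_iff (hM : IsMonomialIdeal P) (hP : P.IsPrime) {e : ℕ}
    {a : Fin n →₀ ℕ} :
    monomial a (1 : K) ∈ P ^ e ↔ e ≤ Finsupp.weight (primeWeight P) a := by
  classical
  rw [hM.mem_pow_iff hP]
  simp [support_monomial]

theorem IsMonomialIdeal.mem_pow_of_mul_mem (hM : IsMonomialIdeal P) (hP : P.IsPrime) {e : ℕ}
    {s f : MvPolynomial (Fin n) K} (hs : s ∉ P) (hsf : s * f ∈ P ^ e) : f ∈ P ^ e := by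
  refine mem_of_forall_monomial_mem fun a ha => ?_
  obtain ⟨b, hb, hba⟩ := (hM.pow e).exists_monomial_mul_mem hP hs hsf ha
  have hwb : Finsupp.weight (primeWeight P) b = 0 := by
    rwa [← pow_one P, hM.monomial_mem_pow_iff hP, Nat.one_le_iff_ne_zero, not_not] at hb
  rw [monomial_mul, one_mul, hM.monomial_mem_pow_iff hP, map_add, hwb, zero_add] at hba
  exact (hM.monomial_mem_pow_iff hP).2 hba

end Monomial

/-! ## Symbolic powers -/

section SymbolicPowers

theorem mem_symbolicPower_iff {R : Type*} [CommRing R] [IsNoetherianRing R] {I : Ideal R} {k : ℕ}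
    {f : R} : f ∈ symbolicPower I k ↔
      ∀ P ∈ associatedPrimes R (R ⧸ I), ∃ s ∉ P, s * f ∈ I ^ k := by
  simp only [symbolicPower, Ideal.mem_iInf, Ideal.mem_comap, Subtype.forall]
  refine forall₂_congr fun P hP => ?_
  have : P.IsPrime := hP.isPrime
  rw [IsLocalization.algebraMap_mem_map_algebraMap_iff P.primeCompl]
  rfl

theorem symbolicPower_one {R : Type*} [CommRing R] [IsNoetherianRing R] (I : Ideal R) :
    symbolicPower I 1 = I := by
  ext f
  rw [mem_symbolicPower_iff]
  constructor
  · intro h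
    by_contra hf
    have hne : (Ideal.Quotient.mk I f) ≠ 0 := fun h0 => hf (Ideal.Quotient.eq_zero_iff_mem.1 h0)
    obtain ⟨P, hP, hle⟩ := exists_le_isAssociatedPrime_of_isNoetherianRing R _ hne
    obtain ⟨s, hs, hsf⟩ := h P hP
    refine hs (hle ?_)
    rw [Submodule.mem_colon_singleton, Submodule.mem_bot, Algebra.smul_def,
      Ideal.Quotient.algebraMap_eq, ← map_mul, Ideal.Quotient.eq_zero_iff_mem]
    simpa using hsf
  · intro hf P hP
    exact ⟨1, (Ideal.ne_top_iff_one P).1 hP.isPrime.ne_top, by simpa using hf⟩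

theorem pow_le_symbolicPower {R : Type*} [CommRing R] [IsNoetherianRing R] (I : Ideal R) (k : ℕ) :
    I ^ k ≤ symbolicPower I k := fun f hf => mem_symbolicPower_iff.2 fun P hP =>
  ⟨1, (Ideal.ne_top_iff_one P).1 hP.isPrime.ne_top, by rwa [one_mul]⟩

variable {K : Type*} [Field K] {n : ℕ} {I : Ideal (MvPolynomial (Fin n) K)}

theorem IsMonomialIdeal.symbolicPower (hI : IsMonomialIdeal I) (k : ℕ) :
    IsMonomialIdeal (symbolicPower I k) := by
  refine isMonomialIdeal_iff.2 fun f hf a ha => mem_symbolicPower_iff.2 fun P hP => ?_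
  obtain ⟨s, hs, hsf⟩ := mem_symbolicPower_iff.1 hf P hP
  obtain ⟨b, hb, hba⟩ := (hI.pow k).exists_monomial_mul_mem hP.isPrime hs hsf ha
  exact ⟨monomial b 1, hb, hba⟩

namespace IsIntersectionType

theorem isMonomialIdeal (hI : IsIntersectionType I) : IsMonomialIdeal I := by
  obtain ⟨m, P, e, hP, rfl⟩ := hI
  exact isMonomialIdeal_iInf fun i => (hP i).2.1.pow (e i)

theorem exists_symbolicPower_le_pow (hI : IsIntersectionType I) {f : MvPolynomial (Fin n) K}
    (hf : f ∉ I) : ∃ (Q : Ideal (MvPolynomial (Fin n) K)) (e : ℕ), Q.IsPrime ∧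
      IsMonomialIdeal Q ∧ f ∉ Q ^ e ∧ ∀ k, symbolicPower I k ≤ Q ^ (e * k) := by
  obtain ⟨m, Q, e, hQ, hIQ⟩ := hI
  rw [← symbolicPower_one I, mem_symbolicPower_iff] at hf
  push Not at hf
  obtain ⟨P, hP, hfP⟩ := hf
  have hPp : P.IsPrime := hP.isPrime
  obtain ⟨i, hiP, hfi⟩ : ∃ i, Q i ≤ P ∧ f ∉ Q i ^ e i := by
    by_contra! h
    classical
    -- The components not contained in `P` contain a common element outside `P`.
    obtain ⟨s, hs, hsP⟩ : ∃ s ∈ ({i | ¬ Q i ≤ P} : Finset (Fin m)).inf fun i => Q i ^ e i,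
        s ∉ P := by
      rw [← SetLike.not_le_iff_exists, hPp.inf_le']
      rintro ⟨i, hi, hle⟩
      exact (Finset.mem_filter.1 hi).2 (hPp.le_of_pow_le hle)
    refine hfP s hsP ?_
    rw [pow_one, hIQ, Ideal.mem_iInf]
    intro i
    by_cases hi : Q i ≤ P
    · exact Ideal.mul_mem_left _ _ (h i hi)
    · exact Ideal.mul_mem_right _ _ (Finset.inf_le (f := fun i => Q i ^ e i) (by simpa using hi) hs)
  refine ⟨Q i, e i, (hQ i).1, (hQ i).2.1, hfi, fun k g hg => ?_⟩
  obtain ⟨s, hs, hsg⟩ := mem_symbolicPower_iff.1 hg P hP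
  refine (hQ i).2.1.mem_pow_of_mul_mem (hQ i).1 (fun h => hs (hiP h)) ?_
  rw [pow_mul]
  exact Ideal.pow_right_mono (hIQ ▸ iInf_le _ i) k hsg

theorem exists_symbolicPower_le_pow_weight (hI : IsIntersectionType I) {a : Fin n →₀ ℕ}
    (ha : monomial a (1 : K) ∈ minimalGenerators I) {i : Fin n} (hai : a i ≠ 0) :
    ∃ Q : Ideal (MvPolynomial (Fin n) K), Q.IsPrime ∧ IsMonomialIdeal Q ∧ primeWeight Q i = 1 ∧
      ∀ k, symbolicPower I k ≤ Q ^ (Finsupp.weight (primeWeight Q) a * k) := by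
  obtain ⟨a₁, haa₁, haI, hmin⟩ := ha
  obtain rfl : a = a₁ := monomial_left_injective one_ne_zero haa₁
  obtain ⟨a', rfl⟩ : ∃ a', a = Finsupp.single i 1 + a' :=
    exists_add_of_le (Finsupp.single_le_iff.2 (Nat.pos_of_ne_zero hai))
  have ha' : monomial a' (1 : K) ∉ I := fun h => by
    simpa using DFunLike.congr_fun (hmin a' h le_add_self) i
  -- `Q ^ e` contains `x^a` but not `x^a / x_i`, so that `x_i ∈ Q` and `x^a` has `Q`-order `e`.
  obtain ⟨Q, e, hQ, hM, haQ, hle⟩ := hI.exists_symbolicPower_le_pow ha'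
  have haw := (hM.monomial_mem_pow_iff hQ).1 (hle 1 ((symbolicPower_one I).symm ▸ haI))
  rw [hM.monomial_mem_pow_iff hQ, not_le] at haQ
  rw [map_add, Finsupp.weight_single, one_smul] at haw
  have hi : primeWeight Q i = 1 := by
    simp only [primeWeight] at haw ⊢
    split_ifs at haw ⊢ <;> omega
  have he : 1 + Finsupp.weight (primeWeight Q) a' = e := by omega
  exact ⟨Q, hQ, hM, hi, by rwa [map_add, Finsupp.weight_single, one_smul, hi, he]⟩

theorem pow_mem_minimalGenerators (hI : IsIntersectionType I) {u : MvPolynomial (Fin n) K}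
    (hu : u ∈ minimalGenerators I) (k : ℕ) :
    u ^ k ∈ minimalGenerators (symbolicPower I k) := by
  obtain ⟨a, rfl, haI, -⟩ := id hu
  refine ⟨k • a, by rw [monomial_pow, one_pow],
    pow_le_symbolicPower I k (Ideal.pow_mem_pow haI k), fun b hb hba => ?_⟩
  by_contra hne
  obtain ⟨i, hbi⟩ : ∃ i, b i < k * a i := by
    by_contra! h
    exact hne (le_antisymm hba fun i => by simpa using h i)
  obtain ⟨Q, hQ, hM, hi, hle⟩ := hI.exists_symbolicPower_le_pow_weight hu (i := i)
    fun h => by simp [h] at hbi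
  -- The order along `Q` of `x^b` is at least that of `x^(k a)`, although `x_i ∈ Q` divides the
  -- quotient `x^(k a) / x^b`.
  have hbw := (hM.monomial_mem_pow_iff hQ).1 (hle k hb)
  obtain ⟨c, hc⟩ := exists_add_of_le hba
  have hci : c i ≠ 0 := fun h => by
    have hi' := DFunLike.congr_fun hc i
    rw [Finsupp.smul_apply, Finsupp.add_apply b c, h, smul_eq_mul] at hi'
    omega
  have hcw : 0 < Finsupp.weight (primeWeight Q) c := calc
    0 < primeWeight Q i := by rw [hi]; exact one_pos
    _ ≤ Finsupp.weight (primeWeight Q) c := Finsupp.le_weight_of_ne_zero' _ hci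
  have hw := congrArg (Finsupp.weight (primeWeight Q)) hc
  rw [map_nsmul, map_add, smul_eq_mul] at hw
  lia

theorem finalDegree_mul_le (hI : IsIntersectionType I) {k : ℕ} (hk : 1 ≤ k) :
    finalDegree I * (k : EReal) ≤ finalDegree (symbolicPower I k) := by
  have hk₀ : (0 : EReal) < (k : EReal) := by exact_mod_cast hk
  rw [← EReal.le_div_iff_mul_le hk₀ (EReal.natCast_ne_top k), hI.isMonomialIdeal.finalDegree_eq]
  refine iSup₂_le fun a ha => ?_
  have hka : monomial (k • a) (1 : K) ∈ minimalGenerators (symbolicPower I k) := by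
    simpa [monomial_pow] using hI.pow_mem_minimalGenerators ha k
  rw [EReal.le_div_iff_mul_le hk₀ (EReal.natCast_ne_top k),
    (hI.isMonomialIdeal.symbolicPower k).finalDegree_eq]
  refine le_iSup₂_of_le (k • a) hka ?_
  rw [map_nsmul, smul_eq_mul, mul_comm]
  norm_cast

end IsIntersectionType

end SymbolicPowers

/-! ## The symbolic Rees algebra -/

section Rees

attribute [local instance] MvPolynomial.gradedAlgebra

variable {K : Type*} [Field K] {n : ℕ} {I : Ideal (MvPolynomial (Fin n) K)}

/-- The symbolic Rees algebra as a module over `T` through its presentation. -/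
abbrev reesModule (I : Ideal (MvPolynomial (Fin n) K)) :
    Module (MvPolynomial (Fin n ⊕ reesGenerators I) K) (symbolicRees I) :=
  Module.compHom _ (reesPresentation I).toRingHom

/-- The scalar multiplication of `reesModule`, which spares instance search a long detour. -/
abbrev reesSMul (I : Ideal (MvPolynomial (Fin n) K)) :
    SMul (MvPolynomial (Fin n ⊕ reesGenerators I) K) (symbolicRees I) :=
  (reesModule I).toSMul

attribute [local instance] reesModule reesSMul

/-- The inclusion of `I^(k)` as the component of degree `k` in `t` of the symbolic Rees algebra. -/
def toRees (I : Ideal (MvPolynomial (Fin n) K)) (k : ℕ) :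
    symbolicPower I k →ₗ[MvPolynomial (Fin n) K] symbolicRees I where
  toFun f := ⟨Polynomial.monomial k f.1, fun l => by
    rw [Polynomial.coeff_monomial]
    split_ifs with h
    exacts [h ▸ f.2, zero_mem _]⟩
  map_add' f g := by ext1; simp
  map_smul' f g := by ext1; simp [Polynomial.smul_monomial]

/-- The projection of the symbolic Rees algebra to its component `I^(k)` of degree `k` in `t`. -/
def ofRees (I : Ideal (MvPolynomial (Fin n) K)) (k : ℕ) :
    symbolicRees I →ₗ[MvPolynomial (Fin n) K] symbolicPower I k where
  toFun x := ⟨(x : Polynomial (MvPolynomial (Fin n) K)).coeff k, x.2 k⟩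
  map_add' f g := by ext1; simp
  map_smul' f g := by ext1; simp

theorem ofRees_comp_toRees (I : Ideal (MvPolynomial (Fin n) K)) (k : ℕ) :
    ofRees I k ∘ₗ toRees I k = LinearMap.id := by
  ext
  simp [ofRees, toRees]

theorem mem_reesDegree_of_eq_monomial {x : symbolicRees I} {f : MvPolynomial (Fin n) K} {k : ℕ}
    (hx : (x : Polynomial (MvPolynomial (Fin n) K)) = Polynomial.monomial k f) {a : ℤ}
    (hf : IsWeightedHomogeneous (fun _ : Fin n => (1 : ℤ)) f a) : x ∈ reesDegree I (a, k) := by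
  intro l
  rw [hx, Polynomial.coeff_monomial]
  split_ifs with h
  · exact ⟨hf, fun hne => absurd (by simp [h]) hne⟩
  · exact ⟨isWeightedHomogeneous_zero K _ _, fun _ => rfl⟩

/-- The bihomogeneous component `reesDegree I c` as a subspace of the symbolic Rees algebra. -/
def reesComponent (I : Ideal (MvPolynomial (Fin n) K)) (c : ℤ × ℤ) :
    Submodule K (symbolicRees I) where
  carrier := reesDegree I c
  zero_mem' _ := ⟨isWeightedHomogeneous_zero K _ _, fun _ => rfl⟩
  add_mem' hx hy k := by
    simp only [Subalgebra.coe_add, Polynomial.coeff_add]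
    exact ⟨(hx k).1.add (hy k).1, fun h => by rw [(hx k).2 h, (hy k).2 h, add_zero]⟩
  smul_mem' r x hx k := by
    change IsWeightedHomogeneous _ (r • (x : Polynomial (MvPolynomial (Fin n) K)).coeff k) _ ∧
      (_ → r • (x : Polynomial (MvPolynomial (Fin n) K)).coeff k = 0)
    exact ⟨(weightedHomogeneousSubmodule K _ _).smul_mem r (hx k).1,
      fun h => (congrArg (r • ·) ((hx k).2 h)).trans (smul_zero r)⟩

instance : SetLike.GradedMonoid (reesComponent I) where
  one_mem := mem_reesDegree_of_eq_monomial (k := 0) rfl (isWeightedHomogeneous_one K _)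
  mul_mem c c' x y hx hy k := by
    simp only [Subalgebra.coe_mul, Polynomial.coeff_mul]
    refine ⟨IsWeightedHomogeneous.sum _ _ _ fun z _ => (hx z.1).1.mul (hy z.2).1,
      fun h => Finset.sum_eq_zero fun z hz => ?_⟩
    have hzk : z.1 + z.2 = k := Finset.HasAntidiagonal.mem_antidiagonal.1 hz
    by_cases h₁ : (z.1 : ℤ) = c.2
    · rw [(hy z.2).2 fun h₂ => h (by rw [Prod.snd_add, ← h₁, ← h₂, ← hzk, Nat.cast_add]), mul_zero]
    · rw [(hx z.1).2 h₁, zero_mul]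

theorem reesPresentation_mem {f : MvPolynomial (Fin n ⊕ reesGenerators I) K} {c : ℤ × ℤ}
    (hf : IsWeightedHomogeneous (reesWeight I) f c) : reesPresentation I f ∈ reesComponent I c := by
  rw [f.as_sum, map_sum]
  refine sum_mem fun d hd => ?_
  rw [← hf (mem_support_iff.1 hd), Finsupp.weight_apply, reesPresentation, aeval_monomial,
    ← Algebra.smul_def]
  refine Submodule.smul_mem _ _ (SetLike.prod_pow_mem_graded _ _ _ _ fun s _ => ?_)
  cases s with
  | inl i => exact mem_reesDegree_of_eq_monomial (k := 0) rfl (isWeightedHomogeneous_X K _ i)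
  | inr g =>
    exact mem_reesDegree_of_eq_monomial rfl
      (isWeightedHomogeneous_monomial _ _ _ (weight_one_int g.1.1))

/-- The component of bidegree `c` of the elements of the symbolic Rees algebra, when all symbolic
powers of `I` are homogeneous. -/
def reesProj (hI : ∀ k, (symbolicPower I k).IsHomogeneous (homogeneousSubmodule (Fin n) K))
    (c : ℤ × ℤ) : symbolicRees I →+ symbolicRees I :=
  if 0 ≤ c.2 then (toRees I c.2.toNat).toAddMonoidHom.comp
    ((idealProj (hI c.2.toNat) c.1).comp (ofRees I c.2.toNat).toAddMonoidHom) else 0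

theorem coeff_reesProj
    (hI : ∀ k, (symbolicPower I k).IsHomogeneous (homogeneousSubmodule (Fin n) K)) (c : ℤ × ℤ)
    (x : symbolicRees I) (k : ℕ) :
    (reesProj hI c x : Polynomial (MvPolynomial (Fin n) K)).coeff k =
      if (k : ℤ) = c.2 then weightedHomogeneousComponent (fun _ : Fin n => (1 : ℤ)) c.1
        ((x : Polynomial (MvPolynomial (Fin n) K)).coeff k) else 0 := by
  obtain ⟨a, b⟩ := c
  rcases le_or_gt 0 b with hb | hb
  · lift b to ℕ using hb
    rcases eq_or_ne k b with rfl | hk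
    · simp [reesProj, toRees, ofRees, idealProj]
    · simp [reesProj, toRees, ofRees, Polynomial.coeff_monomial, hk, hk.symm]
  · rw [reesProj, if_neg hb.not_ge, if_neg (by lia)]
    rfl

theorem gradingProj_rees
    (hI : ∀ k, (symbolicPower I k).IsHomogeneous (homogeneousSubmodule (Fin n) K)) :
    GradingProj (K := K) (reesWeight I) (reesDegree I) (reesProj hI) where
  smul_mem hf hm := SetLike.mul_mem_graded (A := reesComponent I) (reesPresentation_mem hf) hm
  proj_of_mem {c m} hm := by
    classical
    ext1
    refine Polynomial.ext fun k => ?_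
    rw [coeff_reesProj]
    split_ifs with hk
    · exact (hm k).1.weightedHomogeneousComponent_same
    · exact ((hm k).2 hk).symm
  proj_of_ne {c b m} hm hab := by
    classical
    ext1
    refine Polynomial.ext fun k => ?_
    rw [coeff_reesProj]
    split_ifs with hk
    · by_cases hk' : (k : ℤ) = c.2
      · exact (hm k).1.weightedHomogeneousComponent_ne _
          fun h => hab (Prod.ext h (hk.symm.trans hk'))
      · rw [(hm k).2 hk', map_zero]
        rfl
    · rfl
  proj_mem c m k := by
    rw [coeff_reesProj]
    split_ifs with hk
    · exact ⟨weightedHomogeneousComponent_isWeightedHomogeneous _ _, fun h => absurd hk h⟩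
    · exact ⟨isWeightedHomogeneous_zero K _ _, fun _ => rfl⟩

theorem shift_snd_nonneg {F : GradedFreeResolution (K := K) (reesWeight I) (reesDegree I)}
    (hF : F.IsMinimal) (i : ℕ) (j : Fin (F.rank i)) : 0 ≤ (F.shift i j).2 := by
  refine hF.shift_mem (C := (AddSubmonoid.nonneg ℤ).comap (AddMonoidHom.snd ℤ ℤ)) ?_ ?_ i j
  · rintro (_ | g)
    exacts [le_refl (0 : ℤ), Int.natCast_nonneg g.1.2]
  · intro c hc x hx
    ext1
    refine Polynomial.ext fun k => (hx k).2 fun h => hc ?_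
    change 0 ≤ c.2
    exact h ▸ Int.natCast_nonneg k

theorem le_regX {F : GradedFreeResolution (K := K) (reesWeight I) (reesDegree I)}
    (hF : F.IsMinimal) (i : ℕ) (j : Fin (F.rank i)) :
    ((((F.shift i j).1 - i : ℤ) : ℝ) : EReal) ≤ regX I :=
  le_iSup_of_le i (le_iSup₂_of_le (F.shift i j) ⟨F, hF, j, rfl⟩ le_rfl)

/-- `regX I` has the junk value `⊥` when there is no resolution by free modules of finite rank. -/
theorem exists_isMinimal_reesDegree (h : regX I ≠ ⊥) :
    ∃ F : GradedFreeResolution (K := K) (reesWeight I) (reesDegree I), F.IsMinimal := by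
  by_contra! hno
  refine h ?_
  simp only [regX, iSup_eq_bot]
  rintro i c ⟨F, hF, -⟩
  exact absurd hF (hno F)

/-- `K[x, y]` as an algebra over `K[x]`. -/
abbrev sumAlgebra (K : Type*) [Field K] (n : ℕ) (τ : Type*) :
    Algebra (MvPolynomial (Fin n) K) (MvPolynomial (Fin n ⊕ τ) K) :=
  (rename Sum.inl : MvPolynomial (Fin n) K →ₐ[K] MvPolynomial (Fin n ⊕ τ) K).toRingHom.toAlgebra

attribute [local instance] sumAlgebra

instance free_sumAlgebra (τ : Type*) :
    Module.Free (MvPolynomial (Fin n) K) (MvPolynomial (Fin n ⊕ τ) K) := by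
  let e : MvPolynomial (Fin n ⊕ τ) K ≃ₐ[K] MvPolynomial τ (MvPolynomial (Fin n) K) :=
    (renameEquiv K (Equiv.sumComm _ _)).trans (sumAlgEquiv K τ (Fin n))
  have he : e.toAlgHom.comp (rename Sum.inl) = IsScalarTower.toAlgHom K (MvPolynomial (Fin n) K)
      (MvPolynomial τ (MvPolynomial (Fin n) K)) := by
    ext1 i
    simp [e, algebraMap_eq]
  exact Module.Free.of_equiv
    (AlgEquiv.ofRingEquiv (f := e.toRingEquiv) (DFunLike.congr_fun he)).symm.toLinearEquiv

theorem reesPresentation_rename_inl (f : MvPolynomial (Fin n) K) :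
    reesPresentation I (rename Sum.inl f) =
      algebraMap (MvPolynomial (Fin n) K) (symbolicRees I) f := by
  have h : (reesPresentation I).comp (rename Sum.inl) =
      IsScalarTower.toAlgHom K (MvPolynomial (Fin n) K) (symbolicRees I) := by
    ext1 i
    simp [reesPresentation]
  exact DFunLike.congr_fun h f

instance isScalarTower_rees (I : Ideal (MvPolynomial (Fin n) K)) :
    IsScalarTower (MvPolynomial (Fin n) K) (MvPolynomial (Fin n ⊕ reesGenerators I) K)
      (symbolicRees I) where
  smul_assoc f g x := by
    change reesPresentation I (rename Sum.inl f * g) * x = f • (reesPresentation I g * x)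
    rw [map_mul, reesPresentation_rename_inl, Algebra.smul_def, mul_assoc]

theorem weight_mapDomain {α β A : Type*} [AddCommMonoid A] (w : β → A) (φ : α → β) (d : α →₀ ℕ) :
    Finsupp.weight w (d.mapDomain φ) = Finsupp.weight (w ∘ φ) d :=
  Finsupp.linearCombination_mapDomain ℕ φ d

theorem isWeightedHomogeneous_rename_inl {f : MvPolynomial (Fin n) K} {a : ℤ}
    (hf : IsWeightedHomogeneous (fun _ : Fin n => (1 : ℤ)) f a) :
    IsWeightedHomogeneous (reesWeight I) (rename Sum.inl f) (a, 0) := by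
  intro d hd
  obtain ⟨d', rfl, hd'⟩ := coeff_rename_ne_zero _ _ _ hd
  rw [weight_mapDomain, ← hf hd']
  simp only [Finsupp.weight_apply, Finsupp.sum]
  ext <;> simp [reesWeight, Prod.fst_sum, Prod.snd_sum]

theorem GradingProj.strand {M : Type*} [AddCommGroup M] [Module (MvPolynomial (Fin n) K) M]
    [Module (MvPolynomial (Fin n ⊕ reesGenerators I) K) M]
    [IsScalarTower (MvPolynomial (Fin n) K) (MvPolynomial (Fin n ⊕ reesGenerators I) K) M]
    {𝓜 : ℤ × ℤ → Set M} {p : ℤ × ℤ → M →+ M} (h : GradingProj (K := K) (reesWeight I) 𝓜 p)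
    (k : ℤ) : GradingProj (K := K) (fun _ : Fin n => (1 : ℤ)) (fun a => 𝓜 (a, k))
      (fun a => p (a, k)) where
  smul_mem {a b f m} hf hm := by
    have hfm := h.smul_mem (isWeightedHomogeneous_rename_inl hf) hm
    rw [Prod.mk_add_mk, zero_add] at hfm
    rw [algebra_compatible_smul (MvPolynomial (Fin n ⊕ reesGenerators I) K) f m]
    exact hfm
  proj_of_mem hm := h.proj_of_mem hm
  proj_of_ne hm hab := h.proj_of_ne hm (by simpa using hab)
  proj_mem a m := h.proj_mem _ m

theorem weight_reesWeight_comp_inr (c : reesGenerators I →₀ ℕ) :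
    Finsupp.weight (reesWeight I ∘ Sum.inr) c =
      (((c.sum fun g m => m * g.1.1.degree : ℕ) : ℤ), ((c.sum fun g m => m * g.1.2 : ℕ) : ℤ)) := by
  simp only [Finsupp.weight_apply, Finsupp.sum]
  ext <;> simp [reesWeight, Prod.fst_sum, Prod.snd_sum]

theorem exists_le_dMax_of_notMem {ι : Type*} [Finite ι] {s : ι → ℤ × ℤ} (hs : ∀ j, 0 ≤ (s j).2)
    {a : ℤ} {k : ℕ} {y : ι → MvPolynomial (Fin n ⊕ reesGenerators I) K}
    (hy : y ∈ freeDegree K (reesWeight I) s (a, (k : ℤ)))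
    (hym : y ∉ idealOfVars (Fin n) K • (⊤ : Submodule (MvPolynomial (Fin n) K)
      (ι → MvPolynomial (Fin n ⊕ reesGenerators I) K))) :
    ∃ j, (((a - (s j).1 : ℤ) : ℝ) : EReal) ≤ dMax I k := by
  obtain ⟨j, d, hd, hdx⟩ : ∃ j, ∃ d ∈ (y j).support, ∀ i, d (Sum.inl i) = 0 := by
    by_contra! h
    refine hym (mem_smul_top_pi_iff.2 fun j => ?_)
    rw [Ideal.smul_top_eq_map, Submodule.restrictScalars_mem, idealOfVars, Ideal.map_span,
      ← Set.range_comp]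
    have hX : ⇑(algebraMap (MvPolynomial (Fin n) K) (MvPolynomial (Fin n ⊕ reesGenerators I) K)) ∘
        X = X ∘ Sum.inl := funext fun i => rename_X _ i
    rw [hX, Set.range_comp, mem_ideal_span_X_image]
    simpa using h j
  obtain ⟨c, rfl⟩ : ∃ c : reesGenerators I →₀ ℕ, d = c.mapDomain Sum.inr :=
    ⟨_, (Finsupp.mapDomain_comapDomain _ Sum.inr_injective d fun i hi => by
      cases i with
      | inl i => exact absurd (hdx i) (Finsupp.mem_support_iff.1 hi)
      | inr g => exact ⟨g, rfl⟩).symm⟩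
  have hc := hy j (mem_support_iff.1 hd)
  rw [weight_mapDomain, weight_reesWeight_comp_inr, Prod.ext_iff] at hc
  obtain ⟨hdeg, hq⟩ : _ = a - (s j).1 ∧ _ = (k : ℤ) - (s j).2 := hc
  have hqk : (c.sum fun g m => m * g.1.2) ≤ k := by have := hs j; lia
  refine ⟨j, le_iSup₂_of_le c hqk ?_⟩
  rw [← hdeg]
  norm_cast

theorem reg_symbolicPower_le
    (hI : ∀ k, (symbolicPower I k).IsHomogeneous (homogeneousSubmodule (Fin n) K))
    (hreg : regX I ≠ ⊥) (k : ℕ) : reg (symbolicPower I k) ≤ dMax I k + regX I := by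
  obtain ⟨F, hF⟩ := exists_isMinimal_reesDegree hreg
  refine reg_le ?_
  rintro i _ ⟨F', hF', j, rfl⟩
  obtain ⟨y, hy, hym⟩ := hF'.exists_notMem
    (dG := fun i => (F.d i).restrictScalars (MvPolynomial (Fin n) K))
    (εG := F.ε.restrictScalars (MvPolynomial (Fin n) K))
    ⟨F.ε_surjective, F.exact_zero, F.exact_succ⟩
    (fun i => (gradingProj_free (F.shift i)).strand k) (ofRees_comp_toRees I k)
    (fun a m hm => (gradingProj_rees hI).exists_homogeneous_preimage F.ε_homogeneous
      (mem_reesDegree_of_eq_monomial rfl hm) (F.ε_surjective _))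
    (fun i a y hy hy' => (gradingProj_free _).exists_homogeneous_preimage
      (fun l => F.d_homogeneous i l) hy hy') i j
  obtain ⟨l, hl⟩ := exists_le_dMax_of_notMem (shift_snd_nonneg hF i) hy hym
  refine le_trans (le_of_eq ?_) (add_le_add hl (le_regX hF i l))
  rw [← EReal.coe_add, ← Int.cast_add, sub_add_sub_cancel]

end Rees

end SymbolicReg

end

attribute [local instance] MvPolynomial.gradedAlgebra in
open SymbolicReg in
theorem theorem1p2_general {K : Type*} [Field K] {n : ℕ} (I : Ideal (MvPolynomial (Fin n) K))
    (hI : IsIntersectionType I) :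
    (∀ u ∈ minimalGenerators I, ∀ k : ℕ, 1 ≤ k →
      u ^ k ∈ minimalGenerators (symbolicPower I k)) ∧
    (∀ k : ℕ, 1 ≤ k →
      reg (symbolicPower I k) ≥ finalDegree (symbolicPower I k) ∧
      finalDegree (symbolicPower I k) ≥ finalDegree I * (k : EReal)) ∧
    (HasLinearPowers I → ∀ k : ℕ, 1 ≤ k → reg (symbolicPower I k) ≥ reg (I ^ k)) ∧
    (HasLinearPowers I → regX I = 0 →
      (∀ k : ℕ, 1 ≤ k → dMax I k = finalDegree I * (k : EReal)) →
      ∀ k : ℕ, 1 ≤ k → reg (symbolicPower I k) = reg (I ^ k)) := by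
  have hmon := hI.isMonomialIdeal
  have hhom (k : ℕ) := (hmon.symbolicPower k).isHomogeneous
  have hb (k : ℕ) (hk : 1 ≤ k) : finalDegree I * (k : EReal) ≤ reg (symbolicPower I k) :=
    (hI.finalDegree_mul_le hk).trans (finalDegree_le_reg (hhom k))
  have hc (hlin : HasLinearPowers I) (k : ℕ) (hk : 1 ≤ k) :
      reg (I ^ k) ≤ reg (symbolicPower I k) :=
    (hlin.reg_pow hmon.isHomogeneous hk).trans_le (hb k hk)
  refine ⟨fun u hu k _ => hI.pow_mem_minimalGenerators hu k,
    fun k hk => ⟨finalDegree_le_reg (hhom k), hI.finalDegree_mul_le hk⟩, hc,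
    fun hlin hreg hd k hk => le_antisymm ?_ (hc hlin k hk)⟩
  calc reg (symbolicPower I k) ≤ dMax I k + regX I :=
        reg_symbolicPower_le hhom (hreg ▸ EReal.zero_ne_bot) k
    _ = reg (I ^ k) := by rw [hreg, add_zero, hd k hk, hlin.reg_pow hmon.isHomogeneous hk]

theorem theorem1p2 {K : Type*} [Field K] {n : ℕ} (I : Ideal (MvPolynomial (Fin n) K))
    (hI : SymbolicReg.IsMinimalIntersectionType I) :
    (∀ u ∈ SymbolicReg.minimalGenerators I, ∀ k : ℕ, 1 ≤ k →
      u ^ k ∈ SymbolicReg.minimalGenerators (SymbolicReg.symbolicPower I k)) ∧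
    (∀ k : ℕ, 1 ≤ k →
      SymbolicReg.reg (SymbolicReg.symbolicPower I k) ≥
        SymbolicReg.finalDegree (SymbolicReg.symbolicPower I k) ∧
      SymbolicReg.finalDegree (SymbolicReg.symbolicPower I k) ≥
        SymbolicReg.finalDegree I * (k : EReal)) ∧
    (SymbolicReg.HasLinearPowers I → ∀ k : ℕ, 1 ≤ k →
      SymbolicReg.reg (SymbolicReg.symbolicPower I k) ≥ SymbolicReg.reg (I ^ k)) ∧
    (SymbolicReg.HasLinearPowers I → SymbolicReg.regX I = 0 →
      (∀ k : ℕ, 1 ≤ k → SymbolicReg.dMax I k = SymbolicReg.finalDegree I * (k : EReal)) →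
      ∀ k : ℕ, 1 ≤ k →
        SymbolicReg.reg (SymbolicReg.symbolicPower I k) = SymbolicReg.reg (I ^ k)) :=
  theorem1p2_general I hI.1
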